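/- Let $d\ge 0$ be an integer and let $R$ be either the ring $K[[x_1,\dots,x_d]]$ of formal power series over a field $K$, or the ring $\Bbbk\{x_1,\dots,x_d\}$ of convergent power series over $\Bbbk=\mathbb R$ or $\Bbbk=\mathbb C$ (the power series that converge absolutely on some polydisc of positive radius around the origin). Let $<$ be a monomial order, i.e. a total order on the monomials in $x_1,\dots,x_d$ such that $1<g$ for all monomials $g\neq 1$, and $g_1<g_2$ implies $hg_1<hg_2$ for all monomials $g_1,g_2,h$. Assume that $<$ is Noetherian, i.e. for every monomial $g$ there are only finitely many monomials $h$ with $h<g$. For $0\ne f\in R$ let $\operatorname{in}_<(f)$ be the smallest monomial with respect to $<$ that occurs in $f$ with nonzero coefficient, and for an ideal $I$ of $R$ let $\operatorname{in}_<(I)$ be the ideal of $R$ generated by the monomials $\operatorname{in}_<(f)$, $0\neq f\in I$. For $n\ge 0$ let the $n$-jet $j^n(f)$ be the sum of the terms of $f$ of total degree at most $n$. Let $f_1,\dots,f_r$ be a regular sequence in $R$ (that is, $f_i$ is a nonzerodivisor on $R/(f_1,\dots,f_{i-1})$ for $i=1,\dots,r$, and $(f_1,\dots,f_r)\ne R$),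 and let $I=(f_1,\dots,f_r)$. Then there is a number $N$ such that for all $n\ge N$ the jets $j^n(f_1),\dots,j^n(f_r)$ form a regular sequence in $R$ and $$\operatorname{in}_<(I)=\operatorname{in}_<(I'),\qquad\text{where } I'=(j^n(f_1),\dots,j^n(f_r)).$$ -/

import Mathlib

open scoped MonomialOrder

section Monomials

variable {d : ℕ}

/-- A monomial order is Noetherian if every monomial has only finitely many monomials below it.
Monomials in `d` variables are given by their exponents in `Fin d →₀ ℕ`. -/
def MonomialOrder.IsNoetherianOrder (m : MonomialOrder (Fin d)) : Prop :=
  ∀ a : Fin d →₀ ℕ, {b : Fin d →₀ ℕ | b ≺[m] a}.Finite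

/-- `a` is the exponent of the initial monomial of the power series `f`, that is, of the smallest
monomial (with respect to the monomial order `m`) occurring in `f` with nonzero coefficient. -/
def IsInitialExponent {K : Type*} [CommSemiring K] (m : MonomialOrder (Fin d))
    (f : MvPowerSeries (Fin d) K) (a : Fin d →₀ ℕ) : Prop :=
  MvPowerSeries.coeff a f ≠ 0 ∧ ∀ b, MvPowerSeries.coeff b f ≠ 0 → a ≼[m] b

/-- Every nonzero power series has exactly one initial exponent. -/
theorem existsUnique_isInitialExponent {K : Type*} [CommSemiring K] (m : MonomialOrder (Fin d))
    {f : MvPowerSeries (Fin d) K} (hf : f ≠ 0) : ∃! a, IsInitialExponent m f a := by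
  have hne : {s : m.syn | MvPowerSeries.coeff (m.toSyn.symm s) f ≠ 0}.Nonempty := by
    by_contra h
    rw [Set.not_nonempty_iff_eq_empty] at h
    refine hf (MvPowerSeries.ext fun a => ?_)
    by_contra ha
    have : m.toSyn a ∈ {s : m.syn | MvPowerSeries.coeff (m.toSyn.symm s) f ≠ 0} := by
      simpa using ha
    simp [h] at this
  obtain ⟨s, hs, hmin⟩ := WellFounded.has_min (wellFounded_lt (α := m.syn)) _ hne
  refine ⟨m.toSyn.symm s, ⟨hs, fun b hb => ?_⟩, fun b hb => ?_⟩
  · simpa using hmin (m.toSyn b) (by simpa using hb)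
  · apply m.toSyn.injective
    refine le_antisymm (hb.2 _ hs) ?_
    simpa using hmin (m.toSyn b) (by simpa using hb.1)

end Monomials

section Formal

variable {d : ℕ} {K : Type*} [Field K]

/-- The `n`-jet of a formal power series: the sum of its terms of total degree at most `n`. -/
noncomputable def jetPolynomial (n : ℕ) (f : MvPowerSeries (Fin d) K) : MvPolynomial (Fin d) K :=
  MvPowerSeries.truncTotal (n + 1) f

/-- The `n`-jet as an element of the ring of formal power series. -/
noncomputable def formalJet (n : ℕ) (f : MvPowerSeries (Fin d) K) : MvPowerSeries (Fin d) K :=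
  (jetPolynomial n f : MvPowerSeries (Fin d) K)

/-- The initial ideal of an ideal `I` of `K⟦x₁,…,x_d⟧`: the ideal generated by the initial
monomials of the nonzero elements of `I`. -/
noncomputable def formalInitialIdeal (m : MonomialOrder (Fin d))
    (I : Ideal (MvPowerSeries (Fin d) K)) : Ideal (MvPowerSeries (Fin d) K) :=
  Ideal.span {g | ∃ f ∈ I, ∃ a, IsInitialExponent m f a ∧ g = MvPowerSeries.monomial a 1}

end Formal

section Convergent

variable {d : ℕ} {𝕜 : Type*} [RCLike 𝕜]

/-- A power series over `ℝ` or `ℂ` is convergent if it converges absolutely on some polydisc of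
positive radius around the origin. -/
def MvPowerSeries.IsConvergent (f : MvPowerSeries (Fin d) 𝕜) : Prop :=
  ∃ ρ : ℝ, 0 < ρ ∧ Summable fun a : Fin d →₀ ℕ => ‖MvPowerSeries.coeff a f‖ * ρ ^ a.degree

theorem MvPowerSeries.IsConvergent.summable_of_le {f : MvPowerSeries (Fin d) 𝕜} {ρ ρ' : ℝ}
    (h : Summable fun a : Fin d →₀ ℕ => ‖MvPowerSeries.coeff a f‖ * ρ ^ a.degree)
    (h0 : 0 < ρ') (hle : ρ' ≤ ρ) :
    Summable fun a : Fin d →₀ ℕ => ‖MvPowerSeries.coeff a f‖ * ρ' ^ a.degree := by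
  refine Summable.of_nonneg_of_le (fun a => by positivity) (fun a => ?_) h
  gcongr

theorem MvPowerSeries.IsConvergent.add {f g : MvPowerSeries (Fin d) 𝕜}
    (hf : f.IsConvergent) (hg : g.IsConvergent) : (f + g).IsConvergent := by
  obtain ⟨ρ, hρ, hf⟩ := hf
  obtain ⟨σ, hσ, hg⟩ := hg
  have hτ : 0 < min ρ σ := lt_min hρ hσ
  refine ⟨min ρ σ, hτ, ?_⟩
  refine Summable.of_nonneg_of_le (fun a => by positivity) (fun a => ?_)
    ((summable_of_le hf hτ (min_le_left _ _)).add (summable_of_le hg hτ (min_le_right _ _)))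
  rw [← add_mul, map_add]
  gcongr
  exact norm_add_le _ _

theorem MvPowerSeries.IsConvergent.mul {f g : MvPowerSeries (Fin d) 𝕜}
    (hf : f.IsConvergent) (hg : g.IsConvergent) : (f * g).IsConvergent := by
  classical
  obtain ⟨ρ, hρ, hf⟩ := hf
  obtain ⟨σ, hσ, hg⟩ := hg
  have hτ : 0 < min ρ σ := lt_min hρ hσ
  refine ⟨min ρ σ, hτ, ?_⟩
  let F : (Fin d →₀ ℕ) → ℝ := fun a => ‖MvPowerSeries.coeff a f‖ * (min ρ σ) ^ a.degree
  let G : (Fin d →₀ ℕ) → ℝ := fun a => ‖MvPowerSeries.coeff a g‖ * (min ρ σ) ^ a.degree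
  have hF : Summable F := summable_of_le hf hτ (min_le_left _ _)
  have hG : Summable G := summable_of_le hg hτ (min_le_right _ _)
  have hF0 : 0 ≤ F := fun a => mul_nonneg (norm_nonneg _) (pow_nonneg hτ.le _)
  have hG0 : 0 ≤ G := fun a => mul_nonneg (norm_nonneg _) (pow_nonneg hτ.le _)
  have h := summable_sum_mul_antidiagonal_of_summable_mul (hF.mul_of_nonneg hG hF0 hG0)
  refine Summable.of_nonneg_of_le (fun a => by positivity) (fun a => ?_) h
  rw [MvPowerSeries.coeff_mul]
  refine (mul_le_mul_of_nonneg_right (norm_sum_le _ _) (by positivity)).trans ?_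
  rw [Finset.sum_mul]
  refine Finset.sum_le_sum fun p hp => le_of_eq ?_
  rw [Finset.HasAntidiagonal.mem_antidiagonal] at hp
  simp only [F, G]
  rw [← hp, norm_mul, map_add, pow_add]
  ring

theorem MvPowerSeries.isConvergent_coe (p : MvPolynomial (Fin d) 𝕜) :
    (p : MvPowerSeries (Fin d) 𝕜).IsConvergent := by
  refine ⟨1, one_pos, summable_of_ne_finset_zero (s := p.support) fun a ha => ?_⟩
  rw [MvPolynomial.notMem_support_iff] at ha
  simp [ha]

/-- The ring of convergent power series in `d` variables over `𝕜 = ℝ` or `ℂ`. -/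
def ConvergentPowerSeries (d : ℕ) (𝕜 : Type*) [RCLike 𝕜] :
    Subalgebra 𝕜 (MvPowerSeries (Fin d) 𝕜) where
  carrier := {f | f.IsConvergent}
  mul_mem' hf hg := hf.mul hg
  add_mem' hf hg := hf.add hg
  algebraMap_mem' c := by
    have h := MvPowerSeries.isConvergent_coe (MvPolynomial.C c : MvPolynomial (Fin d) 𝕜)
    rwa [MvPolynomial.coe_C] at h

/-- A polynomial, regarded as a convergent power series. -/
def ConvergentPowerSeries.ofPolynomial (p : MvPolynomial (Fin d) 𝕜) :
    ConvergentPowerSeries d 𝕜 :=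
  ⟨(p : MvPowerSeries (Fin d) 𝕜), MvPowerSeries.isConvergent_coe p⟩

/-- The `n`-jet of a convergent power series, as an element of the ring of convergent power
series. -/
noncomputable def convergentJet (n : ℕ) (f : ConvergentPowerSeries d 𝕜) :
    ConvergentPowerSeries d 𝕜 :=
  ConvergentPowerSeries.ofPolynomial (jetPolynomial n (f : MvPowerSeries (Fin d) 𝕜))

/-- The initial ideal of an ideal `I` of the ring of convergent power series: the ideal of that
ring generated by the initial monomials of the nonzero elements of `I`. -/
noncomputable def convergentInitialIdeal (m : MonomialOrder (Fin d))
    (I : Ideal (ConvergentPowerSeries d 𝕜)) : Ideal (ConvergentPowerSeries d 𝕜) :=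
  Ideal.span {g | ∃ f ∈ I, ∃ a, IsInitialExponent m (f : MvPowerSeries (Fin d) 𝕜) a ∧
    g = ConvergentPowerSeries.ofPolynomial (MvPolynomial.monomial a 1)}

end Convergent

/-! By Dickson's lemma finitely many elements of `I` have initial exponents that divide all others.
Together with the `f_p` they form a family `g`, and each `g_j` is a fixed linear combination of the
`f_p`. The same combinations of a close perturbation `f'` have the same initial terms, which gives
one inclusion of initial ideals.

For the other inclusion, a Buchberger-type argument asks that each S-pair of initial terms lifts to
a relation among the new family. A lift for the old family, rewritten in terms of `f`, is a syzygy
of a regular sequence, hence of the form `D f` with `D` alternating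
(`IsRegularFamily.exists_isAlternating`). The same `D` gives the Koszul relation `D f'`, and the
error `D (f - f')` has high order, so the lifts survive (`exists_forall_perturbation`). Applied to a
relation `∑ c_p f'_p = 0`, the reduction shows that `c` is Koszul up to arbitrarily high order;
Krull's intersection theorem then makes `f'` regular (`exists_forall_isRegularFamily`).

Infinite division with respect to the given order is never needed: as the order is Noetherian, its
filtration and the degree filtration are cofinal, and finitely many reductions followed by
Artin–Rees give standard representations. The ring theory used (Noetherianity, Krull, Artin–Rees) is
derived for both rings at once, through `IsSeriesRing`, from division with respect to the auxiliary
order of `primeWeight`. That order has real weights, so weighted `ℓ¹` norms show that the quotients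
converge. -/

open scoped ENNReal
open MvPowerSeries

/-! ### An auxiliary monomial order with real weights -/

section PrimeWeight

variable {d : ℕ}

/-- The integer `∏ pᵢ ^ aᵢ`, where `pᵢ` is the `i`-th prime; comparing these integers gives a
monomial order with real weights. -/
noncomputable def primeWeight (a : Fin d →₀ ℕ) : ℕ := ∏ i : Fin d, Nat.nth Nat.Prime i ^ a i

theorem primeWeight_add (a b : Fin d →₀ ℕ) :
    primeWeight (a + b) = primeWeight a * primeWeight b := by
  simp [primeWeight, pow_add, Finset.prod_mul_distrib]

theorem primeWeight_pos (a : Fin d →₀ ℕ) : 0 < primeWeight a :=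
  Finset.prod_pos fun i _ => pow_pos (Nat.prime_nth_prime i).pos _

theorem factorization_primeWeight (a : Fin d →₀ ℕ) (i : Fin d) :
    (primeWeight a).factorization (Nat.nth Nat.Prime i) = a i := by
  rw [primeWeight, Nat.factorization_prod (S := Finset.univ)
    (g := fun j : Fin d => Nat.nth Nat.Prime j ^ a j)
    fun j _ => (pow_pos (Nat.prime_nth_prime j).pos _).ne']
  rw [Finset.sum_apply', Finset.sum_eq_single i]
  · simp
  · intro j _ hj
    have : Nat.nth Nat.Prime j ≠ Nat.nth Nat.Prime i := fun h =>
      hj (Fin.ext (Nat.nth_injective Nat.infinite_setOfPred_prime h))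
    simp [this]
  · simp

theorem primeWeight_injective : Function.Injective (primeWeight (d := d)) := fun a b h => by
  ext i
  rw [← factorization_primeWeight a, h, factorization_primeWeight]

/-- With `primeWeight_le_pow_degree` this traps negative powers of the weight between powers of two
radii, so that norms weighted by them detect convergence on polydiscs. -/
theorem two_pow_degree_le_primeWeight (a : Fin d →₀ ℕ) : 2 ^ a.degree ≤ primeWeight a := by
  rw [Finsupp.degree_eq_sum, ← Finset.prod_pow_eq_pow_sum]
  exact Finset.prod_le_prod' fun i _ => Nat.pow_le_pow_left (Nat.prime_nth_prime i).two_le _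

theorem primeWeight_le_pow_degree (a : Fin d →₀ ℕ) :
    primeWeight a ≤ Nat.nth Nat.Prime d ^ a.degree := by
  rw [Finsupp.degree_eq_sum, ← Finset.prod_pow_eq_pow_sum]
  exact Finset.prod_le_prod' fun i _ => Nat.pow_le_pow_left
    (Nat.nth_monotone Nat.infinite_setOfPred_prime i.2.le) _

theorem finite_setOf_degree_lt (n : ℕ) : {a : Fin d →₀ ℕ | a.degree < n}.Finite := by
  refine (Set.finite_Iic (Finsupp.equivFunOnFinite.symm fun _ => n)).subset fun a ha i => ?_
  exact (Finsupp.le_degree i a).trans (le_of_lt ha)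

theorem finite_setOf_primeWeight_le (n : ℕ) : {a : Fin d →₀ ℕ | primeWeight a ≤ n}.Finite := by
  refine (finite_setOf_degree_lt n).subset fun a ha => ?_
  exact a.degree.lt_two_pow_self.trans_le ((two_pow_degree_le_primeWeight a).trans ha)

end PrimeWeight

/-! ### Division of formal power series as a fixed point equation -/

theorem exists_eq_of_forall_congr {α K : Type*} [Zero K] (w : α → ℕ) (F : α → (α → K) → K)
    (hF : ∀ a u v, (∀ b, w b < w a → u b = v b) → F a u = F a v) :
    ∃ v : α → K, ∀ a, v a = F a v := by
  classical
  -- Well-founded recursion on the weight; by `hF` the default value 0 at the remaining points has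
  -- no influence.
  let G : ∀ a, (∀ b, (measure w).rel b a → K) → K := fun a ih =>
    F a fun b => if h : w b < w a then ih b h else 0
  refine ⟨(measure w).wf.fix G, fun a => ?_⟩
  rw [WellFounded.fix_eq]
  exact hF _ _ _ fun b hb => by simp [hb]

section Division

variable {d : ℕ} {K : Type*} [Field K] {J : Type*}

/-- The quotients and the remainder of a division are determined by a solution `v` of a fixed point
equation; here `s` chooses a divisor of each divisible monomial. -/
noncomputable def divisionQuotient (β : J → Fin d →₀ ℕ) (s : (Fin d →₀ ℕ) → Option J)
    (v : (Fin d →₀ ℕ) → K) (j : J) : MvPowerSeries (Fin d) K := by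
  classical exact fun c => if s (c + β j) = some j then v (c + β j) else 0

theorem coeff_divisionQuotient [DecidableEq J] (β : J → Fin d →₀ ℕ) (s : (Fin d →₀ ℕ) → Option J)
    (v : (Fin d →₀ ℕ) → K) (j : J) (c : Fin d →₀ ℕ) :
    coeff c (divisionQuotient β s v j) = if s (c + β j) = some j then v (c + β j) else 0 := by
  rw [coeff_apply]
  unfold divisionQuotient
  congr

variable [Fintype J]

/-- Here `h j` plays the role of `monomial (β j) 1 - g j`. Its terms lie strictly above `β j`, so
the right-hand side at `a` involves `v` only at smaller weights and the recursion is solvable. -/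
theorem exists_division_fixedPoint (β : J → Fin d →₀ ℕ) (h : J → MvPowerSeries (Fin d) K)
    (hh : ∀ j e, coeff e (h j) ≠ 0 → primeWeight (β j) < primeWeight e)
    (s : (Fin d →₀ ℕ) → Option J) (u : MvPowerSeries (Fin d) K) :
    ∃ v : (Fin d →₀ ℕ) → K,
      ∀ a, v a = coeff a u + ∑ j, coeff a (divisionQuotient β s v j * h j) := by
  classical
  refine exists_eq_of_forall_congr primeWeight
    (fun a v => coeff a u + ∑ j, coeff a (divisionQuotient β s v j * h j)) ?_
  intro a v w hvw
  congr 1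
  refine Finset.sum_congr rfl fun j _ => ?_
  rw [coeff_mul, coeff_mul]
  refine Finset.sum_congr rfl fun x hx => ?_
  rw [Finset.HasAntidiagonal.mem_antidiagonal] at hx
  by_cases hx2 : coeff x.2 (h j) = 0
  · simp [hx2]
  · have := hh j _ hx2
    rw [coeff_divisionQuotient, coeff_divisionQuotient, hvw (x.1 + β j)]
    rw [← hx, primeWeight_add, primeWeight_add]
    exact Nat.mul_lt_mul_of_pos_left this (primeWeight_pos _)

/-- The sum of the `q_j x^{β_j}` is the part of `v` supported where `s` chooses a divisor. By the
fixed point equation, `u - ∑ q_j g_j` is `v` minus this part. -/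
theorem coeff_sub_sum_divisionQuotient {β : J → Fin d →₀ ℕ} {g : J → MvPowerSeries (Fin d) K}
    {s : (Fin d →₀ ℕ) → Option J} (hs : ∀ a j, s a = some j → β j ≤ a)
    {u : MvPowerSeries (Fin d) K} {v : (Fin d →₀ ℕ) → K}
    (hv : ∀ a, v a = coeff a u +
      ∑ j, coeff a (divisionQuotient β s v j * (monomial (β j) 1 - g j)))
    (a : Fin d →₀ ℕ) (ha : s a ≠ none) :
    coeff a (u - ∑ j, divisionQuotient β s v j * g j) = 0 := by
  classical
  obtain ⟨i, hi⟩ := Option.ne_none_iff_exists'.1 ha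
  have h1 : ∑ j, coeff a (divisionQuotient β s v j * monomial (β j) 1) = v a := by
    rw [Finset.sum_eq_single i]
    · rw [coeff_mul_monomial, if_pos (hs a i hi), coeff_divisionQuotient,
        tsub_add_cancel_of_le (hs a i hi), if_pos hi, mul_one]
    · intro j _ hj
      rw [coeff_mul_monomial]
      split_ifs with hle
      · rw [coeff_divisionQuotient, tsub_add_cancel_of_le hle, if_neg, zero_mul]
        rw [hi]
        simpa using hj.symm
      · rfl
    · simp
  have h2 := hv a
  simp only [mul_sub, map_sub, Finset.sum_sub_distrib, h1] at h2
  rw [map_sub, map_sum]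
  linear_combination -h2

end Division

/-! ### Convergence of the quotients -/

section ConvergentDivision

variable {d : ℕ} {𝕜 : Type*} [RCLike 𝕜]

/-- The weighted `ℓ¹` norm in which the monomial with exponent `a` has weight
`primeWeight a ^ (-t)`. -/
noncomputable def primeWeightNorm (t : ℕ) (f : MvPowerSeries (Fin d) 𝕜) : ℝ≥0∞ :=
  ∑' a, ‖coeff a f‖ₑ * ((primeWeight a : ℝ≥0∞) ^ t)⁻¹

theorem enorm_mul_inv_primeWeight_pow (t : ℕ) (f : MvPowerSeries (Fin d) 𝕜) (a : Fin d →₀ ℕ) :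
    ‖coeff a f‖ₑ * ((primeWeight a : ℝ≥0∞) ^ t)⁻¹ =
      ENNReal.ofReal (‖coeff a f‖ * ((primeWeight a : ℝ) ^ t)⁻¹) := by
  have : (0 : ℝ) < primeWeight a := by exact_mod_cast primeWeight_pos a
  rw [ENNReal.ofReal_mul (norm_nonneg _), ofReal_norm, ENNReal.ofReal_inv_of_pos (by positivity),
    ENNReal.ofReal_pow this.le, ENNReal.ofReal_natCast]

theorem isConvergent_iff_primeWeightNorm_ne_top (f : MvPowerSeries (Fin d) 𝕜) :
    f.IsConvergent ↔ ∃ t, primeWeightNorm t f ≠ ⊤ := by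
  constructor
  · rintro ⟨ρ, hρ, hf⟩
    obtain ⟨t, ht⟩ := exists_pow_lt_of_lt_one hρ (by norm_num : (1 / 2 : ℝ) < 1)
    refine ⟨t, ?_⟩
    have : Summable fun a : Fin d →₀ ℕ => ‖coeff a f‖ * ((primeWeight a : ℝ) ^ t)⁻¹ := by
      refine Summable.of_nonneg_of_le (fun a => by positivity) (fun a => ?_) hf
      have h1 : (2 : ℝ) ^ a.degree ≤ primeWeight a := by
        exact_mod_cast two_pow_degree_le_primeWeight a
      have h2 : ((primeWeight a : ℝ) ^ t)⁻¹ ≤ ((1 / 2) ^ t) ^ a.degree := by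
        rw [one_div, inv_pow, inv_pow, pow_right_comm]
        gcongr
      gcongr
      exact h2.trans (by gcongr)
    simpa only [primeWeightNorm, enorm_mul_inv_primeWeight_pow] using this.tsum_ofReal_ne_top
  · rintro ⟨t, ht⟩
    have hP : (0 : ℝ) < Nat.nth Nat.Prime d := by exact_mod_cast (Nat.prime_nth_prime d).pos
    refine ⟨((Nat.nth Nat.Prime d : ℝ) ^ t)⁻¹, by positivity, ?_⟩
    refine Summable.of_nonneg_of_le (fun a => by positivity) (fun a => ?_)
      (ENNReal.summable_toReal ht)
    rw [enorm_mul_inv_primeWeight_pow, ENNReal.toReal_ofReal (by positivity)]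
    have h1 : (primeWeight a : ℝ) ≤ Nat.nth Nat.Prime d ^ a.degree := by
      exact_mod_cast primeWeight_le_pow_degree a
    have h0 : (0 : ℝ) < primeWeight a := by exact_mod_cast primeWeight_pos a
    gcongr
    rw [inv_pow, pow_right_comm]
    gcongr

theorem primeWeightNorm_anti {s t : ℕ} (hst : s ≤ t) (f : MvPowerSeries (Fin d) 𝕜) :
    primeWeightNorm t f ≤ primeWeightNorm s f := by
  refine ENNReal.tsum_le_tsum fun a => ?_
  gcongr
  exact_mod_cast primeWeight_pos a

theorem inv_primeWeight_pow_add (t : ℕ) (a b : Fin d →₀ ℕ) :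
    ((primeWeight (a + b) : ℝ≥0∞) ^ t)⁻¹ =
      ((primeWeight a : ℝ≥0∞) ^ t)⁻¹ * ((primeWeight b : ℝ≥0∞) ^ t)⁻¹ := by
  rw [primeWeight_add, Nat.cast_mul, mul_pow, ENNReal.mul_inv]
  · right; simp
  · left; simp

theorem tsum_sum_antidiagonal_eq (F G : (Fin d →₀ ℕ) → ℝ≥0∞) :
    ∑' a, ∑ x ∈ Finset.HasAntidiagonal.antidiagonal a, F x.1 * G x.2 = (∑' a, F a) * ∑' b, G b := by
  rw [← ENNReal.tsum_mul_right]
  simp_rw [← ENNReal.tsum_mul_left]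
  rw [← ENNReal.tsum_prod, ← Finset.HasAntidiagonal.sigmaAntidiagonalEquivProd.tsum_eq, ENNReal.tsum_sigma']
  refine tsum_congr fun a => ?_
  rw [tsum_fintype, ← Finset.sum_coe_sort]
  rfl

/-- Weights are integers: if `b` has weight `n`, all terms of `h` have weight at least `n + 1`.
Raising `t` by one thus shrinks the left-hand side by a factor of at most `n / (n + 1)`. -/
theorem exists_primeWeightNorm_le {b : Fin d →₀ ℕ} {h : MvPowerSeries (Fin d) 𝕜}
    (hc : h.IsConvergent) (hh : ∀ e, coeff e h ≠ 0 → primeWeight b < primeWeight e) :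
    ∃ t₀, ∀ t ≥ t₀, primeWeightNorm t h * (primeWeight b : ℝ≥0∞) ^ t ≤ 1 / 2 := by
  obtain ⟨s, hs⟩ := (isConvergent_iff_primeWeightNorm_ne_top h).1 hc
  set n : ℝ≥0∞ := (primeWeight b : ℝ≥0∞) with hn
  have hn0 : n ≠ 0 := by simpa [hn] using (primeWeight_pos b).ne'
  have hnt : n ≠ ⊤ := by simp [hn]
  have key : ∀ k, primeWeightNorm (s + k) h * n ^ (s + k) ≤
      (primeWeightNorm s h * n ^ s) * (n * (n + 1)⁻¹) ^ k := by
    intro k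
    have : primeWeightNorm (s + k) h ≤ primeWeightNorm s h * ((n + 1)⁻¹) ^ k := by
      rw [primeWeightNorm, primeWeightNorm, ← ENNReal.tsum_mul_right]
      refine ENNReal.tsum_le_tsum fun e => ?_
      by_cases he : coeff e h = 0
      · simp [he]
      have h1 : n + 1 ≤ primeWeight e := by
        rw [hn]; exact_mod_cast Nat.succ_le_of_lt (hh e he)
      rw [pow_add, ENNReal.mul_inv (by simp) (by simp), mul_assoc, ← ENNReal.inv_pow]
      gcongr
    calc _ ≤ primeWeightNorm s h * ((n + 1)⁻¹) ^ k * n ^ (s + k) := by gcongr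
      _ = _ := by rw [pow_add, mul_pow]; ring
  have hlt : n * (n + 1)⁻¹ < 1 := by
    rw [← div_eq_mul_inv, ENNReal.div_lt_iff (by simp) (by simp [hnt]), one_mul]
    exact ENNReal.lt_add_right hnt one_ne_zero
  have htend := ENNReal.Tendsto.const_mul
    (ENNReal.tendsto_pow_atTop_nhds_zero_of_lt_one hlt)
    (Or.inr (ENNReal.mul_ne_top hs (ENNReal.pow_ne_top hnt)) :
      (0 : ℝ≥0∞) ≠ 0 ∨ primeWeightNorm s h * n ^ s ≠ ⊤)
  rw [mul_zero] at htend
  obtain ⟨k₀, hk₀⟩ := Filter.eventually_atTop.1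
    (htend.eventually_le_const (by simp : (0 : ℝ≥0∞) < 1 / 2))
  refine ⟨s + k₀, fun t ht => ?_⟩
  obtain ⟨k, rfl⟩ := Nat.exists_eq_add_of_le ((Nat.le_add_right s k₀).trans ht)
  exact (key k).trans (hk₀ k (by omega))

variable {J : Type*}

theorem primeWeightNorm_divisionQuotient_mul_le [DecidableEq J] (t : ℕ) (β : J → Fin d →₀ ℕ)
    (s : (Fin d →₀ ℕ) → Option J) (v : (Fin d →₀ ℕ) → 𝕜) (j : J) :
    primeWeightNorm t (divisionQuotient β s v j) * ((primeWeight (β j) : ℝ≥0∞) ^ t)⁻¹ ≤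
      ∑' a, if s a = some j then ‖v a‖ₑ * ((primeWeight a : ℝ≥0∞) ^ t)⁻¹ else 0 := by
  rw [primeWeightNorm, ← ENNReal.tsum_mul_right]
  refine le_trans (ENNReal.tsum_le_tsum fun c => ?_) (ENNReal.tsum_comp_le_tsum_of_injective
    (add_left_injective (β j)) _)
  rw [mul_assoc, ← inv_primeWeight_pow_add, coeff_divisionQuotient]
  split_ifs <;> simp

variable [Fintype J]

/-- Each exponent is assigned to at most one `j`, so the norms of the `q_j x^{β_j}` add up to at
most the norm of `v`; replacing `x^{β_j}` by `h j` gains the factor 1/2. -/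
theorem tsum_divisionQuotient_le (t : ℕ) (β : J → Fin d →₀ ℕ) (h : J → MvPowerSeries (Fin d) 𝕜)
    (hh : ∀ j, primeWeightNorm t (h j) * (primeWeight (β j) : ℝ≥0∞) ^ t ≤ 1 / 2)
    (s : (Fin d →₀ ℕ) → Option J) (v : (Fin d →₀ ℕ) → 𝕜) :
    ∑ j, primeWeightNorm t (divisionQuotient β s v j) * primeWeightNorm t (h j) ≤
      (∑' a, ‖v a‖ₑ * ((primeWeight a : ℝ≥0∞) ^ t)⁻¹) / 2 := by
  classical
  have hw0 : ∀ a : Fin d →₀ ℕ, ((primeWeight a : ℝ≥0∞) ^ t) ≠ 0 := fun a =>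
    pow_ne_zero _ (by exact_mod_cast (primeWeight_pos a).ne')
  calc _ ≤ ∑ j, (∑' a, if s a = some j then ‖v a‖ₑ * ((primeWeight a : ℝ≥0∞) ^ t)⁻¹ else 0) *
        (1 / 2) := by
        refine Finset.sum_le_sum fun j _ => ?_
        refine le_trans (le_of_eq ?_) (mul_le_mul'
          (primeWeightNorm_divisionQuotient_mul_le t β s v j) (hh j))
        have := ENNReal.inv_mul_cancel (hw0 (β j)) (by simp)
        calc _ = primeWeightNorm t (divisionQuotient β s v j) * primeWeightNorm t (h j) * 1 := by
              rw [mul_one]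
          _ = _ := by rw [← this]; ring
    _ = (∑' a, ∑ j, if s a = some j then ‖v a‖ₑ * ((primeWeight a : ℝ≥0∞) ^ t)⁻¹ else 0) / 2 := by
        rw [← Finset.sum_mul, Summable.tsum_finsetSum fun _ _ => ENNReal.summable, one_div,
          div_eq_mul_inv]
    _ ≤ _ := by
        gcongr with a
        rcases hsa : s a with _ | i
        · simp
        · simp

/-- The fixed point equation gives `‖v‖ ≤ ‖u‖ + ‖v‖ / 2` for large `t`, hence `‖v‖ ≤ 2 ‖u‖`, and the
norm of `v` controls that of each quotient. -/
theorem isConvergent_of_division_fixedPoint {β : J → Fin d →₀ ℕ} {h : J → MvPowerSeries (Fin d) 𝕜}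
    (hc : ∀ j, (h j).IsConvergent)
    (hh : ∀ j e, coeff e (h j) ≠ 0 → primeWeight (β j) < primeWeight e)
    {s : (Fin d →₀ ℕ) → Option J} {u : MvPowerSeries (Fin d) 𝕜} (hu : u.IsConvergent)
    {v : (Fin d →₀ ℕ) → 𝕜}
    (hv : ∀ a, v a = coeff a u + ∑ j, coeff a (divisionQuotient β s v j * h j)) (j : J) :
    (divisionQuotient β s v j).IsConvergent := by
  classical
  choose T hT using fun j => exists_primeWeightNorm_le (hc j) (hh j)
  obtain ⟨t₁, ht₁⟩ := (isConvergent_iff_primeWeightNorm_ne_top u).1 hu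
  let t := max t₁ (Finset.univ.sup T)
  have hTt : ∀ j, primeWeightNorm t (h j) * (primeWeight (β j) : ℝ≥0∞) ^ t ≤ 1 / 2 := fun j =>
    hT j t ((Finset.le_sup (Finset.mem_univ j)).trans (le_max_right _ _))
  have hut : primeWeightNorm t u ≠ ⊤ :=
    ne_top_of_le_ne_top ht₁ (primeWeightNorm_anti (le_max_left _ _) u)
  let W : (Fin d →₀ ℕ) → ℝ≥0∞ := fun a => ((primeWeight a : ℝ≥0∞) ^ t)⁻¹
  have hWt : ∀ a, W a ≠ ⊤ := fun a => by
    simpa [W] using fun h0 => absurd h0 (primeWeight_pos a).ne'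
  -- Absorbing `‖v‖ / 2` requires a finite norm, so `v` is cut off at weight `L`. The equation
  -- survives as an inequality because coefficients of weight at most `L` depend only on such values
  -- of `v`.
  let vL : ℕ → (Fin d →₀ ℕ) → 𝕜 := fun L a => if primeWeight a ≤ L then v a else 0
  have hfin : ∀ L, ∑' a, ‖vL L a‖ₑ * W a ≠ ⊤ := by
    intro L
    rw [tsum_eq_sum (s := (finite_setOf_primeWeight_le (d := d) L).toFinset)]
    · exact (ENNReal.sum_lt_top.2 fun a _ =>
        ENNReal.mul_lt_top (by simp) (hWt a).lt_top).ne
    · intro a ha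
      simp only [Set.Finite.mem_toFinset, Set.mem_ofPred_eq] at ha
      simp [vL, ha]
  have hle : ∀ L a, ‖vL L a‖ₑ * W a ≤ ‖coeff a u‖ₑ * W a +
      ∑ j, ∑ x ∈ Finset.HasAntidiagonal.antidiagonal a, (‖coeff x.1 (divisionQuotient β s (vL L) j)‖ₑ * W x.1) *
        (‖coeff x.2 (h j)‖ₑ * W x.2) := by
    intro L a
    by_cases ha : primeWeight a ≤ L
    swap
    · simp [vL, ha]
    have hq : ∀ j, coeff a (divisionQuotient β s v j * h j) =
        coeff a (divisionQuotient β s (vL L) j * h j) := by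
      intro j
      rw [coeff_mul, coeff_mul]
      refine Finset.sum_congr rfl fun x hx => ?_
      rw [Finset.HasAntidiagonal.mem_antidiagonal] at hx
      by_cases hx2 : coeff x.2 (h j) = 0
      · simp [hx2]
      · have h1 := hh j _ hx2
        have h2 : primeWeight (x.1 + β j) ≤ L := by
          refine le_trans ?_ ha
          rw [← hx, primeWeight_add, primeWeight_add]
          exact Nat.mul_le_mul_left _ h1.le
        simp [coeff_divisionQuotient, vL, h2]
    have h0 : vL L a = v a := by simp [vL, ha]
    rw [h0, hv a]
    simp_rw [hq]
    calc _ ≤ (‖coeff a u‖ₑ + ∑ j, ∑ x ∈ Finset.HasAntidiagonal.antidiagonal a,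
          ‖coeff x.1 (divisionQuotient β s (vL L) j)‖ₑ * ‖coeff x.2 (h j)‖ₑ) * W a := by
          gcongr
          refine (enorm_add_le _ _).trans ?_
          gcongr
          refine (enorm_sum_le _ _).trans ?_
          gcongr with j
          rw [coeff_mul]
          refine (enorm_sum_le _ _).trans ?_
          gcongr with x
          rw [enorm_mul]
      _ = _ := by
          rw [add_mul, Finset.sum_mul]
          congr 1
          refine Finset.sum_congr rfl fun j _ => ?_
          rw [Finset.sum_mul]
          refine Finset.sum_congr rfl fun x hx => ?_
          rw [Finset.HasAntidiagonal.mem_antidiagonal] at hx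
          simp only [W]
          rw [← hx, inv_primeWeight_pow_add]
          ring
  have hbound : ∀ L, ∑' a, ‖vL L a‖ₑ * W a ≤ 2 * primeWeightNorm t u := by
    intro L
    have h1 : ∑' a, ‖vL L a‖ₑ * W a ≤ primeWeightNorm t u + (∑' a, ‖vL L a‖ₑ * W a) / 2 := by
      refine (ENNReal.tsum_le_tsum (hle L)).trans ?_
      rw [ENNReal.tsum_add, Summable.tsum_finsetSum fun _ _ => ENNReal.summable]
      refine add_le_add le_rfl (le_trans (le_of_eq ?_) (tsum_divisionQuotient_le t β h hTt s (vL L)))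
      refine Finset.sum_congr rfl fun j _ => ?_
      exact tsum_sum_antidiagonal_eq
        (fun a => ‖coeff a (divisionQuotient β s (vL L) j)‖ₑ * W a) fun a => ‖coeff a (h j)‖ₑ * W a
    set V := ∑' a, ‖vL L a‖ₑ * W a with hV
    have hV2 : V / 2 ≠ ⊤ := ENNReal.div_ne_top (hfin L) two_ne_zero
    have h2 : V / 2 + V / 2 ≤ primeWeightNorm t u + V / 2 := by rwa [ENNReal.add_halves]
    have h3 : V / 2 ≤ primeWeightNorm t u := (ENNReal.add_le_add_iff_right hV2).1 h2
    rw [← ENNReal.add_halves V, two_mul]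
    exact add_le_add h3 h3
  have hV : ∑' a, ‖v a‖ₑ * W a ≤ 2 * primeWeightNorm t u := by
    rw [ENNReal.tsum_eq_iSup_sum]
    refine iSup_le fun S => ?_
    refine le_trans ?_ (hbound (S.sup primeWeight))
    refine le_trans (Finset.sum_le_sum fun a ha => le_of_eq ?_) (ENNReal.sum_le_tsum S)
    simp [vL, Finset.le_sup (f := primeWeight) ha]
  have hj := primeWeightNorm_divisionQuotient_mul_le t β s v j
  have hj2 : (∑' a, if s a = some j then ‖v a‖ₑ * W a else 0) ≤ ∑' a, ‖v a‖ₑ * W a :=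
    ENNReal.tsum_le_tsum fun a => by split_ifs <;> simp
  refine (isConvergent_iff_primeWeightNorm_ne_top _).2 ⟨t, fun htop => ?_⟩
  rw [htop, ENNReal.top_mul (by simp)] at hj
  exact ENNReal.mul_ne_top (by simp) hut (top_le_iff.1 ((hj.trans hj2).trans hV))

end ConvergentDivision

/-! ### Commutative algebra of rings of power series -/

theorem exists_finset_forall_exists_le {d : ℕ} (E : Set (Fin d →₀ ℕ)) :
    ∃ B : Finset (Fin d →₀ ℕ), (∀ b ∈ B, b ∈ E) ∧ ∀ a ∈ E, ∃ b ∈ B, b ≤ a := by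
  -- Dickson's lemma: the minimal elements form an antichain in a well-quasi-order.
  have hfin : {a | Minimal (· ∈ E) a}.Finite :=
    (setOfPred_minimal_antichain (· ∈ E)).finite_of_partiallyWellOrderedOn
      (Set.isPWO_of_wellQuasiOrderedLE _)
  refine ⟨hfin.toFinset, fun b hb => ?_, fun a ha => ?_⟩
  · exact ((Set.Finite.mem_toFinset _).1 hb).1
  · obtain ⟨b, hba, hb⟩ := exists_minimal_le_of_wellFoundedLT (· ∈ E) a ha
    exact ⟨b, (Set.Finite.mem_toFinset _).2 hb, hba⟩

theorem exists_le_degree_eq {d n : ℕ} {b : Fin d →₀ ℕ} (h : n ≤ b.degree) :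
    ∃ a ≤ b, a.degree = n := by
  induction n with
  | zero => exact ⟨0, zero_le, by simp⟩
  | succ n ih =>
    obtain ⟨a, hab, ha⟩ := ih (by omega)
    obtain ⟨i, hi⟩ : ∃ i, a i < b i := by
      by_contra! hcon
      have : b.degree ≤ a.degree := Finsupp.degree_mono hcon
      omega
    refine ⟨a + Finsupp.single i 1, fun j => ?_, by simp [ha]⟩
    rcases eq_or_ne i j with rfl | hij
    · simpa using hi
    · simpa [Finsupp.single_eq_of_ne' hij] using hab j

/-- A ring of power series: it contains the monomials and admits division with remainder with
respect to the monomial order given by `primeWeight`. -/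
structure IsSeriesRing {d : ℕ} {K A : Type*} [Field K] [CommRing A]
    (φ : A →+* MvPowerSeries (Fin d) K) : Prop where
  injective : Function.Injective φ
  exists_monomial : ∀ (a : Fin d →₀ ℕ) (k : K), ∃ x, φ x = monomial a k
  exists_division : ∀ {J : Type} [Fintype J] (β : J → Fin d →₀ ℕ) (g : J → A),
    (∀ j, coeff (β j) (φ (g j)) = 1) →
    (∀ j b, coeff b (φ (g j)) ≠ 0 → b ≠ β j → primeWeight (β j) < primeWeight b) →
    ∀ u, ∃ q : J → A, ∀ b j, β j ≤ b → coeff b (φ (u - ∑ j, q j * g j)) = 0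

namespace IsSeriesRing

variable {d : ℕ} {K A : Type*} [Field K] [CommRing A] {φ : A →+* MvPowerSeries (Fin d) K}

/-- The ideal of series without terms of degree less than `n`. -/
def orderIdeal (φ : A →+* MvPowerSeries (Fin d) K) (n : ℕ) : Ideal A where
  carrier := {u | ∀ b : Fin d →₀ ℕ, b.degree < n → coeff b (φ u) = 0}
  zero_mem' := by simp
  add_mem' {u v} hu hv b hb := by simp [hu b hb, hv b hb]
  smul_mem' c u hu b hb := by
    classical
    rw [smul_eq_mul, map_mul, coeff_mul]
    refine Finset.sum_eq_zero fun x hx => ?_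
    rw [Finset.HasAntidiagonal.mem_antidiagonal] at hx
    rw [hu x.2, mul_zero]
    rw [← hx, map_add] at hb
    omega

theorem orderIdeal_anti {n k : ℕ} (h : n ≤ k) : orderIdeal φ k ≤ orderIdeal φ n :=
  fun _ hu b hb => hu b (hb.trans_le h)

theorem orderIdeal_mul_le (n k : ℕ) :
    orderIdeal φ n * orderIdeal φ k ≤ orderIdeal φ (n + k) := by
  classical
  refine Ideal.mul_le.2 fun u hu v hv b hb => ?_
  rw [map_mul, coeff_mul]
  refine Finset.sum_eq_zero fun x hx => ?_
  rw [Finset.HasAntidiagonal.mem_antidiagonal] at hx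
  rw [← hx, map_add] at hb
  rcases lt_or_ge x.1.degree n with h | h
  · rw [hu _ h, zero_mul]
  · rw [hv x.2 (by omega), mul_zero]

theorem pow_le_orderIdeal (n : ℕ) : orderIdeal φ 1 ^ n ≤ orderIdeal φ n := by
  induction n with
  | zero => exact fun u _ b hb => absurd hb (Nat.not_lt_zero _)
  | succ n ih =>
    rw [pow_succ]
    exact (Ideal.mul_mono_left ih).trans (orderIdeal_mul_le n 1)

variable (hφ : IsSeriesRing φ)

include hφ in
theorem exists_primeWeight_lt {f : A} (hf : f ≠ 0) :
    ∃ a, coeff a (φ f) ≠ 0 ∧ ∀ b, coeff b (φ f) ≠ 0 → b ≠ a → primeWeight a < primeWeight b := by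
  have hne : {a | coeff a (φ f) ≠ 0}.Nonempty := by
    by_contra h
    rw [Set.not_nonempty_iff_eq_empty, Set.eq_empty_iff_forall_notMem] at h
    refine hf (hφ.injective (MvPowerSeries.ext fun a => ?_))
    simpa using h a
  refine ⟨Function.argminOn primeWeight _ hne, Function.argminOn_mem primeWeight _ hne,
    fun b hb hba => lt_of_le_of_ne (Function.argminOn_le primeWeight _ hb) fun h => ?_⟩
  exact hba (primeWeight_injective h).symm

/-- The monomial with exponent `a` and coefficient `k`. -/
noncomputable def mon (a : Fin d →₀ ℕ) (k : K) : A := (hφ.exists_monomial a k).choose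

@[simp]
theorem map_mon (a : Fin d →₀ ℕ) (k : K) : φ (hφ.mon a k) = monomial a k :=
  (hφ.exists_monomial a k).choose_spec

theorem mon_mul_mon (a b : Fin d →₀ ℕ) (k l : K) :
    hφ.mon a k * hφ.mon b l = hφ.mon (a + b) (k * l) :=
  hφ.injective (by simp [monomial_mul_monomial])

theorem mon_mem_pow {n : ℕ} {a : Fin d →₀ ℕ} (ha : a.degree = n) :
    hφ.mon a 1 ∈ orderIdeal φ 1 ^ n := by
  classical
  induction n generalizing a with
  | zero => simp
  | succ n ih =>
    have hne : a ≠ 0 := by rintro rfl; simp at ha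
    obtain ⟨i, hi⟩ : ∃ i, a i ≠ 0 := by simpa using DFunLike.ne_iff.1 hne
    have hle : Finsupp.single i 1 ≤ a := by
      rw [Finsupp.single_le_iff]; omega
    have hd : (a - Finsupp.single i 1).degree = n := by
      have := congrArg Finsupp.degree (tsub_add_cancel_of_le hle)
      rw [map_add, ha, Finsupp.degree_single] at this
      omega
    rw [← tsub_add_cancel_of_le hle, ← mul_one (1 : K), ← hφ.mon_mul_mon, pow_succ]
    refine Ideal.mul_mem_mul (ih hd) fun b hb => ?_
    rw [map_mon, coeff_monomial, if_neg]
    rintro rfl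
    simp at hb

include hφ

/-- Division of 1 by the normalized `f`, whose leading exponent is 0, leaves no remainder, as every
exponent is at least 0. -/
theorem isUnit_of_coeff_zero_ne_zero {f : A} (hf : coeff 0 (φ f) ≠ 0) : IsUnit f := by
  obtain ⟨q, hq⟩ := hφ.exists_division (J := Unit) (fun _ => 0)
    (fun _ => hφ.mon 0 (coeff 0 (φ f))⁻¹ * f)
    (fun _ => by
      simp only [map_mul, map_mon]
      rw [coeff_monomial_mul, if_pos le_rfl, tsub_zero, inv_mul_cancel₀ hf])
    (fun _ b _ hb => by
      refine lt_of_le_of_ne ?_ fun h => hb (primeWeight_injective h).symm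
      have h0 : primeWeight (0 : Fin d →₀ ℕ) = 1 := by simp [primeWeight]
      exact h0.trans_le (primeWeight_pos b)) 1
  have h0 : 1 - ∑ j, q j * (hφ.mon 0 (coeff 0 (φ f))⁻¹ * f) = 0 :=
    hφ.injective (MvPowerSeries.ext fun b => by simpa using hq b () (zero_le))
  refine IsUnit.of_mul_eq_one (q () * hφ.mon 0 (coeff 0 (φ f))⁻¹) ?_
  simp only [Finset.univ_unique, Finset.sum_singleton, sub_eq_zero] at h0
  rw [h0]
  ring

theorem orderIdeal_one_le_jacobson : orderIdeal φ 1 ≤ Ideal.jacobson ⊥ := fun x hx => by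
  refine Ideal.mem_jacobson_bot.2 fun y => hφ.isUnit_of_coeff_zero_ne_zero ?_
  have := (orderIdeal φ 1).mul_mem_right y hx 0 (by simp)
  rw [map_add, map_add, this]
  simp

/-- Division by all monomials of degree `n` removes every term of degree at least `n`; the remainder
has no terms of lower degree either, hence vanishes. -/
theorem orderIdeal_eq_pow (n : ℕ) : orderIdeal φ n = orderIdeal φ 1 ^ n := by
  refine le_antisymm (fun u hu => ?_) (pow_le_orderIdeal n)
  have hfin : Finite {a : Fin d →₀ ℕ // a.degree = n} :=
    ((finite_setOf_degree_lt (n + 1)).subset fun a (ha : a.degree = n) => by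
      simp [ha]).to_subtype
  have := Fintype.ofFinite {a : Fin d →₀ ℕ // a.degree = n}
  obtain ⟨q, hq⟩ := hφ.exists_division (J := {a : Fin d →₀ ℕ // a.degree = n}) Subtype.val
    (fun j => hφ.mon j 1) (fun j => by simp [coeff_monomial_same])
    (fun j b hb hbj => by classical simp [coeff_monomial, hbj] at hb) u
  have hsum : ∑ j, q j * hφ.mon j.1 1 ∈ orderIdeal φ 1 ^ n :=
    Ideal.sum_mem _ fun j _ => Ideal.mul_mem_left _ _ (hφ.mon_mem_pow j.2)
  have h0 : u - ∑ j, q j * hφ.mon j.1 1 = 0 := by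
    refine hφ.injective (MvPowerSeries.ext fun b => ?_)
    rw [map_zero, map_zero]
    rcases lt_or_ge b.degree n with hb | hb
    · exact (orderIdeal φ n).sub_mem hu (pow_le_orderIdeal n hsum) b hb
    · obtain ⟨a, hab, ha⟩ := exists_le_degree_eq hb
      exact hq b ⟨a, ha⟩ hab
  rw [sub_eq_zero.1 h0]
  exact hsum

/-- Elements of `I` whose leading exponents for `primeWeight` generate all the others generate `I`:
a nonzero remainder would lie in `I` and have a leading exponent divisible by one of them. -/
theorem isNoetherianRing : IsNoetherianRing A := by
  rw [isNoetherianRing_iff_ideal_fg]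
  intro I
  obtain ⟨B, hB, hle⟩ := exists_finset_forall_exists_le {a : Fin d →₀ ℕ | ∃ f ∈ I,
    coeff a (φ f) ≠ 0 ∧ ∀ b, coeff b (φ f) ≠ 0 → b ≠ a → primeWeight a < primeWeight b}
  choose f hfI hf0 hf using fun b : B => hB b b.2
  let g : B → A := fun b => hφ.mon 0 (coeff b.1 (φ (f b)))⁻¹ * f b
  have hg : ∀ b c, coeff c (φ (g b)) = (coeff b.1 (φ (f b)))⁻¹ * coeff c (φ (f b)) := by
    intro b c
    simp only [g, map_mul, map_mon]
    rw [coeff_monomial_mul, if_pos zero_le, tsub_zero]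
  have hgI : ∀ b, g b ∈ I := fun b => I.mul_mem_left _ (hfI b)
  suffices I = Ideal.span (Set.range g) by
    rw [this]
    exact Submodule.fg_span (Set.finite_range g)
  refine le_antisymm (fun u hu => ?_) (Ideal.span_le.2 (Set.range_subset_iff.2 hgI))
  obtain ⟨q, hq⟩ := hφ.exists_division (J := B) Subtype.val g
    (fun b => by rw [hg, inv_mul_cancel₀ (hf0 b)])
    (fun b c hc hcb => hf b c (by rw [hg] at hc; exact right_ne_zero_of_mul hc) hcb) u
  have hmem : u - ∑ b, q b * g b ∈ I :=
    I.sub_mem hu (I.sum_mem fun b _ => I.mul_mem_left _ (hgI b))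
  have h0 : u - ∑ b, q b * g b = 0 := by
    by_contra hne
    obtain ⟨a, ha, hmin⟩ := hφ.exists_primeWeight_lt hne
    obtain ⟨b, hb, hba⟩ := hle a ⟨_, hmem, ha, hmin⟩
    exact ha (hq a ⟨b, hb⟩ hba)
  rw [sub_eq_zero.1 h0]
  exact Ideal.sum_mem _ fun b _ => Ideal.mul_mem_left _ _ (Ideal.subset_span ⟨b, rfl⟩)

/-- A weak form of the Artin–Rees lemma. -/
theorem exists_inf_orderIdeal_le (I : Ideal A) (c : ℕ) :
    ∃ n, ∀ u ∈ I, u ∈ orderIdeal φ n → u ∈ orderIdeal φ c * I := by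
  have := hφ.isNoetherianRing
  obtain ⟨k, hk⟩ := Ideal.exists_pow_inf_eq_pow_smul (orderIdeal φ 1) (M := A) I
  refine ⟨c + k, fun u huI hu => ?_⟩
  have h := hk (c + k) (by omega)
  have hu2 : u ∈ (orderIdeal φ 1 ^ (c + k) • ⊤ ⊓ I : Submodule A A) := by
    refine ⟨?_, huI⟩
    rw [hφ.orderIdeal_eq_pow] at hu
    simpa using hu
  rw [h, Nat.add_sub_cancel] at hu2
  rw [hφ.orderIdeal_eq_pow]
  exact Submodule.smul_mono le_rfl inf_le_right hu2

/-- Krull's intersection theorem: ideals are closed. -/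
theorem mem_of_forall_exists_sub_mem (I : Ideal A) {x : A}
    (h : ∀ n, ∃ y ∈ I, x - y ∈ orderIdeal φ n) : x ∈ I := by
  have := hφ.isNoetherianRing
  have hI := Ideal.iInf_pow_smul_eq_bot_of_le_jacobson (M := A ⧸ I) (orderIdeal φ 1)
    hφ.orderIdeal_one_le_jacobson
  rw [← Ideal.Quotient.eq_zero_iff_mem, ← Submodule.mem_bot A, ← hI, Submodule.mem_iInf]
  intro n
  obtain ⟨y, hy, hxy⟩ := h n
  rw [hφ.orderIdeal_eq_pow] at hxy
  have : Ideal.Quotient.mk I x = (x - y) • (1 : A ⧸ I) := by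
    rw [Algebra.smul_def, mul_one, Ideal.Quotient.algebraMap_eq, map_sub,
      Ideal.Quotient.eq_zero_iff_mem.2 hy, sub_zero]
  rw [this]
  exact Submodule.smul_mem_smul hxy trivial

end IsSeriesRing

/-! ### Regular sequences and Koszul syzygies -/

section Syzygies

variable {A : Type*} [CommRing A]

/-- Each member of the family is a nonzerodivisor modulo the preceding ones. -/
def IsRegularFamily {r : ℕ} (f : Fin r → A) : Prop :=
  ∀ i x, f i * x ∈ Ideal.span (f '' Set.Iio i) → x ∈ Ideal.span (f '' Set.Iio i)

theorem ofList_take_ofFn {r : ℕ} (f : Fin r → A) (i : Fin r) :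
    Ideal.ofList ((List.ofFn f).take i) = Ideal.span (f '' Set.Iio i) := by
  unfold Ideal.ofList
  congr 1
  ext x
  simp only [Set.mem_ofPred_eq, List.mem_take_iff_getElem, List.getElem_ofFn, List.length_ofFn,
    Set.mem_image, Set.mem_Iio]
  constructor
  · rintro ⟨j, hj, rfl⟩
    exact ⟨⟨j, by omega⟩, by simpa [Fin.lt_def] using (lt_min_iff.1 hj).1, rfl⟩
  · rintro ⟨j, hj, rfl⟩
    exact ⟨j, lt_min hj j.2, rfl⟩

theorem ofList_ofFn {r : ℕ} (f : Fin r → A) :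
    Ideal.ofList (List.ofFn f) = Ideal.span (Set.range f) := by
  unfold Ideal.ofList
  congr 1
  ext x
  simp

theorem isWeaklyRegular_ofFn_iff {r : ℕ} (f : Fin r → A) :
    RingTheory.Sequence.IsWeaklyRegular A (List.ofFn f) ↔ IsRegularFamily f := by
  have key : ∀ i : Fin r, IsSMulRegular (A ⧸ (Ideal.ofList ((List.ofFn f).take i) •
      (⊤ : Submodule A A))) (f i) ↔
      ∀ x, f i * x ∈ Ideal.span (f '' Set.Iio i) → x ∈ Ideal.span (f '' Set.Iio i) := by
    intro i
    rw [isSMulRegular_quotient_iff_mem_of_smul_mem, ofList_take_ofFn]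
    simp
  rw [RingTheory.Sequence.isWeaklyRegular_iff]
  constructor
  · intro h i
    exact (key i).1 (by simpa using h i (by simp))
  · intro h i hi
    have := (key ⟨i, by simpa using hi⟩).2 (h _)
    simpa using this

theorem isRegular_ofFn_iff {r : ℕ} (f : Fin r → A) :
    RingTheory.Sequence.IsRegular A (List.ofFn f) ↔
      IsRegularFamily f ∧ Ideal.span (Set.range f) ≠ ⊤ := by
  rw [RingTheory.Sequence.isRegular_iff, isWeaklyRegular_ofFn_iff, ofList_ofFn]
  simp [eq_comm]

theorem image_castSucc_Iio {A : Type*} {r : ℕ} (f : Fin (r + 1) → A) (i : Fin r) :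
    f '' Set.Iio i.castSucc = (fun j : Fin r => f j.castSucc) '' Set.Iio i := by
  ext x
  constructor
  · rintro ⟨j, hj, rfl⟩
    have hj' : (j : ℕ) < i := hj
    exact ⟨⟨j, by omega⟩, hj', rfl⟩
  · rintro ⟨j, hj, rfl⟩
    exact ⟨j.castSucc, hj, rfl⟩

theorem image_last_Iio {A : Type*} {r : ℕ} (f : Fin (r + 1) → A) :
    f '' Set.Iio (Fin.last r) = Set.range fun j : Fin r => f j.castSucc := by
  ext x
  constructor
  · rintro ⟨j, hj, rfl⟩
    exact ⟨⟨j, hj⟩, rfl⟩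
  · rintro ⟨j, rfl⟩
    exact ⟨j.castSucc, Fin.castSucc_lt_last j, rfl⟩

theorem IsRegularFamily.castSucc {r : ℕ} {f : Fin (r + 1) → A} (hf : IsRegularFamily f) :
    IsRegularFamily fun j : Fin r => f j.castSucc := fun i x hx => by
  rw [← image_castSucc_Iio] at hx ⊢
  exact hf _ x hx

theorem isRegularFamily_succ {r : ℕ} {f : Fin (r + 1) → A}
    (hf : IsRegularFamily fun j : Fin r => f j.castSucc)
    (hlast : ∀ x, f (Fin.last r) * x ∈ Ideal.span (Set.range fun j : Fin r => f j.castSucc) →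
      x ∈ Ideal.span (Set.range fun j : Fin r => f j.castSucc)) :
    IsRegularFamily f := fun i => by
  induction i using Fin.lastCases with
  | last => rwa [image_last_Iio]
  | cast i => rw [image_castSucc_Iio]; exact hf i

/-- A matrix is alternating if it is skew-symmetric with zero diagonal. -/
def Matrix.IsAlternating {n : Type*} (D : Matrix n n A) : Prop :=
  (∀ i j, D i j = -D j i) ∧ ∀ i, D i i = 0

/-- Off-diagonal terms cancel in pairs. The zero diagonal is a separate condition because of
characteristic 2. -/
theorem Matrix.IsAlternating.sum_mul_sum_eq_zero {r : ℕ} {D : Matrix (Fin r) (Fin r) A}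
    (hD : D.IsAlternating) (f : Fin r → A) : ∑ p, (∑ q, D p q * f q) * f p = 0 := by
  induction r with
  | zero => simp
  | succ r ih =>
    have h := ih (D := fun p q => D p.castSucc q.castSucc)
      ⟨fun i j => hD.1 _ _, fun i => hD.2 _⟩ fun p => f p.castSucc
    simp only [Fin.sum_univ_castSucc, add_mul, Finset.sum_add_distrib, h, hD.2]
    rw [Finset.sum_mul]
    simp only [zero_mul, add_zero, zero_add, ← Finset.sum_add_distrib]
    refine Finset.sum_eq_zero fun i _ => ?_
    rw [hD.1 i.castSucc (Fin.last r)]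
    ring

/-- The syzygies of a regular sequence are the Koszul syzygies. -/
theorem IsRegularFamily.exists_isAlternating {r : ℕ} {f : Fin r → A} (hf : IsRegularFamily f)
    {s : Fin r → A} (hs : ∑ p, s p * f p = 0) :
    ∃ D : Matrix (Fin r) (Fin r) A, D.IsAlternating ∧ ∀ p, s p = ∑ q, D p q * f q := by
  induction r with
  | zero => exact ⟨0, ⟨fun i => i.elim0, fun i => i.elim0⟩, fun p => p.elim0⟩
  | succ r ih =>
    rw [Fin.sum_univ_castSucc] at hs
    -- Regularity writes the last coefficient as a combination `e` of the earlier `f_p`.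
    -- Substitution leaves a relation among the earlier ones, and the matrix found for it is
    -- bordered by `e` and `-e`.
    have hlast := hf (Fin.last r) (s (Fin.last r)) (by
      rw [image_last_Iio, mul_comm, ← neg_eq_of_add_eq_zero_right hs]
      exact neg_mem (Ideal.sum_mem _ fun i _ => Ideal.mul_mem_left _ _
        (Ideal.subset_span ⟨i, rfl⟩)))
    rw [image_last_Iio, Ideal.mem_span_range_iff_exists_fun] at hlast
    obtain ⟨e, he⟩ := hlast
    obtain ⟨D, hD, hDs⟩ := ih hf.castSucc
      (s := fun p => s p.castSucc + e p * f (Fin.last r)) (by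
        rw [← hs, ← he, Finset.sum_mul, ← Finset.sum_add_distrib]
        refine Finset.sum_congr rfl fun p _ => ?_
        ring)
    let D' : Matrix (Fin (r + 1)) (Fin (r + 1)) A := fun p q =>
      Fin.lastCases (motive := fun _ => A)
        (Fin.lastCases (motive := fun _ => A) 0 (fun q => e q) q)
        (fun p => Fin.lastCases (motive := fun _ => A) (-e p) (fun q => D p q) q) p
    refine ⟨D', ⟨fun i j => ?_, fun i => ?_⟩, fun p => ?_⟩
    · induction i using Fin.lastCases with
      | last => induction j using Fin.lastCases <;> simp [D']
      | cast i =>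
        induction j using Fin.lastCases with
        | last => simp [D']
        | cast j => simpa [D'] using hD.1 i j
    · induction i using Fin.lastCases with
      | last => simp [D']
      | cast i => simpa [D'] using hD.2 i
    · rw [Fin.sum_univ_castSucc]
      induction p using Fin.lastCases with
      | last => simpa [D'] using he.symm
      | cast p =>
        simp only [D', Fin.lastCases_castSucc, Fin.lastCases_last]
        rw [← hDs p]
        ring

end Syzygies

/-! ### Induction along a Noetherian order -/

section NoetherianOrder

variable {d : ℕ} {m : MonomialOrder (Fin d)}

/-- With finitely many monomials below each one, every monomial other than 1 has an immediate
predecessor, so there are no limit steps. -/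
theorem MonomialOrder.IsNoetherianOrder.induction (hm : m.IsNoetherianOrder)
    {P : (Fin d →₀ ℕ) → Prop} (zero : P 0)
    (step : ∀ a b, (∀ c, a ≺[m] c → b ≼[m] c) → P a → P b) (a : Fin d →₀ ℕ) : P a := by
  have key : ∀ s : m.syn, P (m.toSyn.symm s) := by
    intro s
    induction s using WellFoundedLT.induction with
    | ind s ih =>
      rcases Set.eq_empty_or_nonempty {b | b ≺[m] m.toSyn.symm s} with h | h
      · have hs : m.toSyn.symm s = 0 := by
          by_contra hne
          refine Set.eq_empty_iff_forall_notMem.1 h 0 ?_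
          have h1 : 0 < s := m.toSyn_lt_iff_ne_zero.2 fun h0 => hne (by simp [h0])
          simpa using h1
        rwa [hs]
      · obtain ⟨b, hb, hmax⟩ := Set.exists_max_image _ m.toSyn (hm _) h
        have hb' : m.toSyn b < s := by simpa using hb
        refine step b _ (fun c hc => ?_) (by simpa using ih _ hb')
        by_contra hlt
        exact absurd (hmax c (not_le.1 hlt)) (not_le.2 hc)
  simpa using key (m.toSyn a)

theorem MonomialOrder.IsNoetherianOrder.exists_degree (hm : m.IsNoetherianOrder)
    (a : Fin d →₀ ℕ) : ∃ n, ∀ b : Fin d →₀ ℕ, n ≤ b.degree → a ≺[m] b := by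
  obtain ⟨n, hn⟩ := ((hm a).image Finsupp.degree).bddAbove
  refine ⟨max n a.degree + 1, fun b hb => ?_⟩
  rcases lt_trichotomy (m.toSyn a) (m.toSyn b) with h | h | h
  · exact h
  · rw [m.toSyn.injective h] at hb
    omega
  · have := hn ⟨b, h, rfl⟩
    omega

end NoetherianOrder

/-- Used with `P a` for "no terms below `a`" and `Q a` for "only terms above `a`": `lt` cancels the
term at `a`, and `step` passes to the next monomial. -/
theorem MonomialOrder.IsNoetherianOrder.induction_lt {d : ℕ} {m : MonomialOrder (Fin d)}
    (hm : m.IsNoetherianOrder) {P Q : (Fin d →₀ ℕ) → Prop} (zero : P 0) (lt : ∀ a, P a → Q a)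
    (step : ∀ a b, (∀ c, a ≺[m] c → b ≼[m] c) → Q a → P b) (a : Fin d →₀ ℕ) : Q a :=
  lt a (hm.induction zero (fun a b h hP => step a b h (lt a hP)) a)

theorem MonomialOrder.exists_forall_le {d : ℕ} (m : MonomialOrder (Fin d))
    {S : Set (Fin d →₀ ℕ)} (hS : S.Finite) : ∃ a, ∀ b ∈ S, b ≼[m] a := by
  obtain ⟨s, hs⟩ := (hS.image m.toSyn).bddAbove
  exact ⟨m.toSyn.symm s, fun b hb => by simpa using hs ⟨b, hb, rfl⟩⟩

/-! ### The filtration by the given monomial order -/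

namespace IsSeriesRing

section Level

variable {d : ℕ} {K A : Type*} [Field K] [CommRing A] {φ : A →+* MvPowerSeries (Fin d) K}
  {m : MonomialOrder (Fin d)}

variable (m φ) in
/-- The series whose product with the monomial of exponent `e` has only terms above `a`. -/
def ltIdeal (a e : Fin d →₀ ℕ) : Ideal A where
  carrier := {u | ∀ b, coeff b (φ u) ≠ 0 → a ≺[m] (b + e)}
  zero_mem' := by simp
  add_mem' {u v} hu hv b hb := by
    by_cases h : coeff b (φ u) = 0
    · exact hv b (by simpa [h] using hb)
    · exact hu b h
  smul_mem' c u hu b hb := by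
    classical
    rw [smul_eq_mul, map_mul, coeff_mul] at hb
    obtain ⟨x, hx, hne⟩ := Finset.exists_ne_zero_of_sum_ne_zero hb
    rw [Finset.HasAntidiagonal.mem_antidiagonal] at hx
    refine (hu x.2 (right_ne_zero_of_mul hne)).trans_le (m.toSyn_monotone ?_)
    rw [← hx]
    gcongr
    exact le_add_self

variable (m φ) in
/-- The series whose product with the monomial of exponent `e` has no terms below `a`. -/
def leIdeal (a e : Fin d →₀ ℕ) : Ideal A where
  carrier := {u | ∀ b, coeff b (φ u) ≠ 0 → a ≼[m] (b + e)}
  zero_mem' := by simp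
  add_mem' {u v} hu hv b hb := by
    by_cases h : coeff b (φ u) = 0
    · exact hv b (by simpa [h] using hb)
    · exact hu b h
  smul_mem' c u hu b hb := by
    classical
    rw [smul_eq_mul, map_mul, coeff_mul] at hb
    obtain ⟨x, hx, hne⟩ := Finset.exists_ne_zero_of_sum_ne_zero hb
    rw [Finset.HasAntidiagonal.mem_antidiagonal] at hx
    refine (hu x.2 (right_ne_zero_of_mul hne)).trans (m.toSyn_monotone ?_)
    rw [← hx]
    gcongr
    exact le_add_self

theorem ltIdeal_le_leIdeal {a b : Fin d →₀ ℕ} (h : ∀ c, a ≺[m] c → b ≼[m] c) (e : Fin d →₀ ℕ) :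
    ltIdeal φ m a e ≤ leIdeal φ m b e := fun _ hu c hc => h _ (hu c hc)

theorem mem_leIdeal_zero (u : A) (e : Fin d →₀ ℕ) : u ∈ leIdeal φ m 0 e := fun b _ => by simp

theorem mul_mem_ltIdeal {a e : Fin d →₀ ℕ} {u g : A} (hu : u ∈ ltIdeal φ m a e)
    (hg : IsInitialExponent m (φ g) e) : u * g ∈ ltIdeal φ m a 0 := by
  classical
  intro b hb
  rw [map_mul, coeff_mul] at hb
  obtain ⟨x, hx, hne⟩ := Finset.exists_ne_zero_of_sum_ne_zero hb
  rw [Finset.HasAntidiagonal.mem_antidiagonal] at hx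
  refine (hu x.1 (left_ne_zero_of_mul hne)).trans_le ?_
  rw [← hx, add_zero, map_add, map_add]
  gcongr
  exact hg.2 _ (right_ne_zero_of_mul hne)

theorem mul_mem_leIdeal {a e : Fin d →₀ ℕ} {u g : A} (hu : u ∈ leIdeal φ m a e)
    (hg : IsInitialExponent m (φ g) e) : u * g ∈ leIdeal φ m a 0 := by
  classical
  intro b hb
  rw [map_mul, coeff_mul] at hb
  obtain ⟨x, hx, hne⟩ := Finset.exists_ne_zero_of_sum_ne_zero hb
  rw [Finset.HasAntidiagonal.mem_antidiagonal] at hx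
  refine (hu x.1 (left_ne_zero_of_mul hne)).trans ?_
  rw [← hx, add_zero, map_add, map_add]
  gcongr
  exact hg.2 _ (right_ne_zero_of_mul hne)

theorem mem_ltIdeal_of_coeff_eq_zero {a : Fin d →₀ ℕ} {u : A} (hu : u ∈ leIdeal φ m a 0)
    (h : coeff a (φ u) = 0) : u ∈ ltIdeal φ m a 0 := fun b hb => by
  refine lt_of_le_of_ne (hu b hb) fun hab => hb ?_
  rw [add_zero] at hab
  rwa [← m.toSyn.injective hab]

theorem coeff_eq_zero_of_mem_ltIdeal {a : Fin d →₀ ℕ} {u : A} (hu : u ∈ ltIdeal φ m a 0) :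
    coeff a (φ u) = 0 := by
  by_contra h
  simpa using hu a h

/-- Together with `exists_ltIdeal_le_orderIdeal` and `exists_degree`, this makes the filtrations by
degree and by a Noetherian order cofinal. -/
theorem orderIdeal_le_ltIdeal {a : Fin d →₀ ℕ} {n : ℕ}
    (h : ∀ b : Fin d →₀ ℕ, n ≤ b.degree → a ≺[m] b) (e : Fin d →₀ ℕ) :
    orderIdeal φ n ≤ ltIdeal φ m a e := fun u hu b hb => by
  have hn : n ≤ b.degree := by
    by_contra hlt
    exact hb (hu b (not_le.1 hlt))
  exact (h b hn).trans_le (m.toSyn_monotone (le_self_add))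

variable (m φ) in
theorem exists_ltIdeal_le_orderIdeal {J : Type*} [Finite J] (β : J → Fin d →₀ ℕ) (n : ℕ) :
    ∃ a, ∀ j, ltIdeal φ m a (β j) ≤ orderIdeal φ n := by
  obtain ⟨a, ha⟩ := m.exists_forall_le
    (Set.finite_iUnion fun j => (finite_setOf_degree_lt (d := d) n).image (· + β j))
  refine ⟨a, fun j u hu b hb => ?_⟩
  by_contra hne
  exact absurd (hu b hne) (not_lt.2 (ha _ (Set.mem_iUnion.2 ⟨j, b, hb, rfl⟩)))

variable (hφ : IsSeriesRing φ)

theorem mon_zero (a : Fin d →₀ ℕ) : hφ.mon a 0 = 0 := hφ.injective (by simp)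

theorem mon_sum {J : Type*} (s : Finset J) (a : Fin d →₀ ℕ) (k : J → K) :
    hφ.mon a (∑ j ∈ s, k j) = ∑ j ∈ s, hφ.mon a (k j) :=
  hφ.injective (by simp)

theorem mon_mem_ltIdeal {a b e : Fin d →₀ ℕ} (h : a ≺[m] (b + e)) (k : K) :
    hφ.mon b k ∈ ltIdeal φ m a e := fun c hc => by
  classical
  rw [map_mon, coeff_monomial] at hc
  rwa [(ite_ne_right_iff.1 hc).1]

theorem mon_mem_leIdeal {a b e : Fin d →₀ ℕ} (h : a ≼[m] (b + e)) (k : K) :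
    hφ.mon b k ∈ leIdeal φ m a e := fun c hc => by
  classical
  rw [map_mon, coeff_monomial] at hc
  rwa [(ite_ne_right_iff.1 hc).1]

theorem mon_mul_mem_ltIdeal {a b e : Fin d →₀ ℕ} {u : A} (hu : u ∈ ltIdeal φ m a e) (k : K) :
    hφ.mon b k * u ∈ ltIdeal φ m (b + a) e := fun c hc => by
  rw [map_mul, map_mon, coeff_monomial_mul] at hc
  obtain ⟨hle, hne⟩ := ite_ne_right_iff.1 hc
  have := hu _ (right_ne_zero_of_mul hne)
  rw [← add_tsub_cancel_of_le hle, add_assoc, map_add, map_add m.toSyn b]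
  gcongr

/-- The coefficient that multiplies the monomial `a` after multiplication by the monomial `e`. -/
noncomputable def shiftedCoeff (φ : A →+* MvPowerSeries (Fin d) K) (a e : Fin d →₀ ℕ) (u : A) :
    K := by
  classical exact if e ≤ a then coeff (a - e) (φ u) else 0

theorem le_of_shiftedCoeff_ne_zero {a e : Fin d →₀ ℕ} {u : A} (h : shiftedCoeff φ a e u ≠ 0) :
    e ≤ a := by
  by_contra hle
  exact h (by simp [shiftedCoeff, hle])

theorem sub_mon_mem_ltIdeal {a e : Fin d →₀ ℕ} {u : A} (hu : u ∈ leIdeal φ m a e) :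
    u - hφ.mon (a - e) (shiftedCoeff φ a e u) ∈ ltIdeal φ m a e := by
  classical
  have hmem : u - hφ.mon (a - e) (shiftedCoeff φ a e u) ∈ leIdeal φ m a e := by
    refine Ideal.sub_mem _ hu ?_
    -- If `e` does not divide `a`, no term of `u` is shifted to `a`; `shiftedCoeff` is then 0 and
    -- the truncated `a - e` is harmless.
    by_cases h : e ≤ a
    · exact hφ.mon_mem_leIdeal (by rw [tsub_add_cancel_of_le h]) _
    · simp [shiftedCoeff, h, mon_zero]
  intro b hb
  refine lt_of_le_of_ne (hmem b hb) fun hab => hb ?_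
  have hab' := m.toSyn.injective hab
  subst hab'
  simp [shiftedCoeff]

include hφ in
theorem coeff_mul_eq_shiftedCoeff {a e : Fin d →₀ ℕ} {u g : A} (hu : u ∈ leIdeal φ m a e)
    (hg : IsInitialExponent m (φ g) e) :
    coeff a (φ (u * g)) = shiftedCoeff φ a e u * coeff e (φ g) := by
  have h := coeff_eq_zero_of_mem_ltIdeal (mul_mem_ltIdeal (hφ.sub_mon_mem_ltIdeal hu) hg)
  rw [sub_mul, map_sub, map_sub, sub_eq_zero] at h
  rw [h, map_mul, map_mon, coeff_monomial_mul, if_pos tsub_le_self]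
  by_cases hle : e ≤ a
  · rw [tsub_tsub_cancel_of_le hle]
  · simp [shiftedCoeff, hle]

end Level

/-! ### Standard representations and lifting of syzygies -/

section StandardBasis

variable {d : ℕ} {K A : Type*} [Field K] [CommRing A] {φ : A →+* MvPowerSeries (Fin d) K}
  {m : MonomialOrder (Fin d)} {J : Type*} [Fintype J] {β : J → Fin d →₀ ℕ} {g : J → A}

theorem sum_mul_mem_ltIdeal (hg : ∀ j, IsInitialExponent m (φ (g j)) (β j)) {a : Fin d →₀ ℕ}
    {c : J → A} (hc : ∀ j, c j ∈ ltIdeal φ m a (β j)) : ∑ j, c j * g j ∈ ltIdeal φ m a 0 :=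
  Ideal.sum_mem _ fun j _ => mul_mem_ltIdeal (hc j) (hg j)

theorem sum_mul_mem_leIdeal (hg : ∀ j, IsInitialExponent m (φ (g j)) (β j)) {a : Fin d →₀ ℕ}
    {c : J → A} (hc : ∀ j, c j ∈ leIdeal φ m a (β j)) : ∑ j, c j * g j ∈ leIdeal φ m a 0 :=
  Ideal.sum_mem _ fun j _ => mul_mem_leIdeal (hc j) (hg j)

theorem isInitialExponent_of_mem_leIdeal {a : Fin d →₀ ℕ} {u : A} (hu : u ∈ leIdeal φ m a 0)
    (h : coeff a (φ u) ≠ 0) : IsInitialExponent m (φ u) a :=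
  ⟨h, fun b hb => by simpa using hu b hb⟩

variable (hφ : IsSeriesRing φ)

-- Each step cancels the initial term of the remainder by a multiple of some `g j`. That term lies
-- above `l`, hence so do the products with which `e` is built.
include hφ in
theorem exists_reduction (hm : m.IsNoetherianOrder)
    (hg : ∀ j, IsInitialExponent m (φ (g j)) (β j)) {I : Ideal A} (hgI : ∀ j, g j ∈ I)
    (hstd : ∀ u ∈ I, ∀ a, IsInitialExponent m (φ u) a → ∃ j, β j ≤ a)
    {l : Fin d →₀ ℕ} {u : A} (huI : u ∈ I) (hu : u ∈ ltIdeal φ m l 0) (a : Fin d →₀ ℕ) :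
    ∃ e : J → A, (∀ j, e j ∈ ltIdeal φ m l (β j)) ∧ u - ∑ j, e j * g j ∈ ltIdeal φ m a 0 := by
  classical
  refine hm.induction_lt (P := fun a => ∃ e : J → A, (∀ j, e j ∈ ltIdeal φ m l (β j)) ∧
    u - ∑ j, e j * g j ∈ leIdeal φ m a 0)
    (Q := fun a => ∃ e : J → A, (∀ j, e j ∈ ltIdeal φ m l (β j)) ∧
    u - ∑ j, e j * g j ∈ ltIdeal φ m a 0) ⟨0, fun j => zero_mem _, mem_leIdeal_zero _ _⟩ ?_
    (fun a b h ⟨e, he, hr⟩ => ⟨e, he, ltIdeal_le_leIdeal h 0 hr⟩) a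
  rintro a ⟨e, he, hr⟩
  by_cases h0 : coeff a (φ (u - ∑ j, e j * g j)) = 0
  · exact ⟨e, he, mem_ltIdeal_of_coeff_eq_zero hr h0⟩
  set r := u - ∑ j, e j * g j with hrdef
  have hrI : r ∈ I := I.sub_mem huI (I.sum_mem fun j _ => I.mul_mem_left _ (hgI j))
  have hrl : r ∈ ltIdeal φ m l 0 := Ideal.sub_mem _ hu (sum_mul_mem_ltIdeal hg he)
  obtain ⟨j, hj⟩ := hstd r hrI a (isInitialExponent_of_mem_leIdeal hr h0)
  have hla : l ≺[m] a := by simpa using hrl a h0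
  let q := hφ.mon (a - β j) (coeff a (φ r) * (coeff (β j) (φ (g j)))⁻¹)
  have hsum : ∑ i, (e + Pi.single j q : J → A) i * g i = ∑ i, e i * g i + q * g j := by
    simp only [Pi.add_apply, add_mul, Finset.sum_add_distrib]
    congr 1
    rw [Finset.sum_eq_single j]
    · simp
    · intro i _ hi
      simp [hi]
    · simp
  refine ⟨e + Pi.single j q, fun i => Ideal.add_mem _ (he i) ?_, ?_⟩
  · rcases eq_or_ne i j with rfl | hij
    · rw [Pi.single_eq_same]
      exact hφ.mon_mem_ltIdeal (by rwa [tsub_add_cancel_of_le hj]) _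
    · simp [hij]
  · rw [hsum, ← sub_sub, ← hrdef]
    have hq : q ∈ leIdeal φ m a (β j) := hφ.mon_mem_leIdeal (by rw [tsub_add_cancel_of_le hj]) _
    refine mem_ltIdeal_of_coeff_eq_zero (Ideal.sub_mem _ hr (mul_mem_leIdeal hq (hg j))) ?_
    rw [map_sub, map_sub, map_mul, map_mon, coeff_monomial_mul, if_pos tsub_le_self,
      tsub_tsub_cancel_of_le hj, inv_mul_cancel_right₀ (hg j).1, sub_self]

-- Finitely many reductions bring the remainder into a high power of the maximal ideal. Artin–Rees
-- expresses it through the `g j` with coefficients of order at least `c`, which is enough to lie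
-- above `l`.
include hφ in
theorem exists_standard_representation (hm : m.IsNoetherianOrder)
    (hg : ∀ j, IsInitialExponent m (φ (g j)) (β j))
    (hstd : ∀ u ∈ Ideal.span (Set.range g), ∀ a, IsInitialExponent m (φ u) a → ∃ j, β j ≤ a)
    {l : Fin d →₀ ℕ} {u : A} (huI : u ∈ Ideal.span (Set.range g)) (hu : u ∈ ltIdeal φ m l 0) :
    ∃ e : J → A, (∀ j, e j ∈ ltIdeal φ m l (β j)) ∧ ∑ j, e j * g j = u := by
  obtain ⟨c, hc⟩ := hm.exists_degree l
  obtain ⟨n, hn⟩ := hφ.exists_inf_orderIdeal_le (Ideal.span (Set.range g)) c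
  obtain ⟨a, ha⟩ := exists_ltIdeal_le_orderIdeal φ m (fun _ : Unit => (0 : Fin d →₀ ℕ)) n
  have hgI : ∀ j, g j ∈ Ideal.span (Set.range g) := fun j => Ideal.subset_span ⟨j, rfl⟩
  obtain ⟨e, he, hr⟩ := hφ.exists_reduction hm hg hgI hstd huI hu a
  have h := hn _ (Ideal.sub_mem _ huI (Ideal.sum_mem _ fun j _ => Ideal.mul_mem_left _ _ (hgI j)))
    (ha () hr)
  rw [← smul_eq_mul, Ideal.span, Submodule.mem_ideal_smul_span_iff_exists_sum] at h
  obtain ⟨w, hw, hsum⟩ := h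
  refine ⟨e + w, fun j => Ideal.add_mem _ (he j) (orderIdeal_le_ltIdeal hc _ (hw j)), ?_⟩
  rw [Finsupp.sum_fintype _ _ (by simp)] at hsum
  simp only [smul_eq_mul] at hsum
  simp only [Pi.add_apply, add_mul, Finset.sum_add_distrib, hsum]
  ring

/-- The syzygy of monomials that cancels the initial terms of the `i`-th and `j`-th series. -/
noncomputable def sPair [DecidableEq J] (β : J → Fin d →₀ ℕ) (lc : J → K) (i j : J) : J → A :=
  Pi.single i (hφ.mon (β i ⊔ β j - β i) (lc i)⁻¹) - Pi.single j (hφ.mon (β i ⊔ β j - β j) (lc j)⁻¹)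

theorem sum_single_mul [DecidableEq J] (i : J) (x : A) (g : J → A) :
    ∑ k, (Pi.single i x : J → A) k * g k = x * g i := by
  rw [Finset.sum_eq_single i]
  · simp
  · intro k _ hk
    simp [hk]
  · simp

theorem sum_sPair_mul_mem_ltIdeal [DecidableEq J]
    (hg : ∀ j, IsInitialExponent m (φ (g j)) (β j)) (i j : J) :
    ∑ k, hφ.sPair β (fun j => coeff (β j) (φ (g j))) i j k * g k ∈
      ltIdeal φ m (β i ⊔ β j) 0 := by
  simp only [sPair, Pi.sub_apply, sub_mul, Finset.sum_sub_distrib, sum_single_mul]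
  have key : ∀ k, β k ≤ β i ⊔ β j → ∀ c,
      hφ.mon (β i ⊔ β j - β k) c * g k ∈ leIdeal φ m (β i ⊔ β j) 0 := fun k hk c =>
    mul_mem_leIdeal (hφ.mon_mem_leIdeal (by rw [tsub_add_cancel_of_le hk]) _) (hg k)
  refine mem_ltIdeal_of_coeff_eq_zero (Ideal.sub_mem _ (key i le_sup_left _)
    (key j le_sup_right _)) ?_
  rw [map_sub, map_sub, map_mul φ, map_mul φ, map_mon, map_mon, coeff_monomial_mul, coeff_monomial_mul,
    if_pos tsub_le_self, if_pos tsub_le_self, tsub_tsub_cancel_of_le le_sup_left,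
    tsub_tsub_cancel_of_le le_sup_right, inv_mul_cancel₀ (hg i).1, inv_mul_cancel₀ (hg j).1,
    sub_self]

/-- The level-`a` terms of `c` form a syzygy of the initial terms. Such syzygies are combinations of
S-pairs with one fixed pivot `o`, and each S-pair is replaced by its lift in `T`, at the cost of
terms above `a`. -/
theorem exists_sub_mem_ltIdeal [DecidableEq J] {lc : J → K} (hlc : ∀ j, lc j ≠ 0)
    {T : Submodule A (J → A)} {e : J → J → J → A}
    (he : ∀ i j k, e i j k ∈ ltIdeal φ m (β i ⊔ β j) (β k))
    (hT : ∀ i j, hφ.sPair β lc i j - e i j ∈ T) {a : Fin d →₀ ℕ} {c : J → A}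
    (hc : ∀ j, c j ∈ leIdeal φ m a (β j))
    (hsum : ∑ j, shiftedCoeff φ a (β j) (c j) * lc j = 0) :
    ∃ t ∈ T, ∀ j, (c - t) j ∈ ltIdeal φ m a (β j) := by
  set γ : J → K := fun j => shiftedCoeff φ a (β j) (c j) with hγ
  have hcγ : ∀ j, c j - hφ.mon (a - β j) (γ j) ∈ ltIdeal φ m a (β j) := fun j =>
    hφ.sub_mon_mem_ltIdeal (hc j)
  by_cases h0 : ∀ j, γ j = 0
  · exact ⟨0, zero_mem _, fun j => by simpa [h0, mon_zero] using hcγ j⟩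
  push Not at h0
  obtain ⟨o, ho⟩ := h0
  have hle : ∀ j, γ j ≠ 0 → β j ⊔ β o ≤ a := fun j hj =>
    sup_le (le_of_shiftedCoeff_ne_zero hj) (le_of_shiftedCoeff_ne_zero ho)
  let x : J → A := fun j => hφ.mon (a - β j ⊔ β o) (γ j * lc j)
  refine ⟨∑ j, x j • (hφ.sPair β lc j o - e j o),
    Submodule.sum_mem _ fun j _ => Submodule.smul_mem _ _ (hT j o), fun k => ?_⟩
  have h1 : ∀ j, x j * hφ.sPair β lc j o k =
      (Pi.single j (hφ.mon (a - β j) (γ j)) : J → A) k -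
        (Pi.single o (hφ.mon (a - β o) (γ j * lc j * (lc o)⁻¹)) : J → A) k := by
    intro j
    by_cases hj : γ j = 0
    · simp [x, hj, mon_zero]
    · have hs := hle j hj
      have hA : ∀ b, b ≤ β j ⊔ β o → a - (β j ⊔ β o) + (β j ⊔ β o - b) = a - b := fun b hb =>
        tsub_add_tsub_cancel hs hb
      have hm1 : x j * hφ.mon (β j ⊔ β o - β j) (lc j)⁻¹ = hφ.mon (a - β j) (γ j) := by
        rw [mon_mul_mon, hA _ le_sup_left, mul_inv_cancel_right₀ (hlc j)]
      have hm2 : x j * hφ.mon (β j ⊔ β o - β o) (lc o)⁻¹ =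
          hφ.mon (a - β o) (γ j * lc j * (lc o)⁻¹) := by
        rw [mon_mul_mon, hA _ le_sup_right]
      rw [sPair, Pi.sub_apply, mul_sub, ← hm1, ← hm2]
      congr 1 <;> simp only [Pi.single_apply, mul_ite, mul_zero]
  have h2 : ∑ j, x j * hφ.sPair β lc j o k = hφ.mon (a - β k) (γ k) := by
    simp_rw [h1, Finset.sum_sub_distrib]
    rw [Finset.sum_pi_single]
    -- The contributions collected at the pivot cancel exactly because the level-`a` terms form a
    -- syzygy.
    have : ∑ j, (Pi.single o (hφ.mon (a - β o) (γ j * lc j * (lc o)⁻¹)) : J → A) k = 0 := by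
      rcases eq_or_ne k o with rfl | hk
      · simp only [Pi.single_eq_same]
        rw [← mon_sum, ← Finset.sum_mul, hsum, zero_mul, mon_zero]
      · simp [hk]
    rw [this, sub_zero, if_pos (Finset.mem_univ _)]
  have h3 : (c - ∑ j, x j • (hφ.sPair β lc j o - e j o)) k =
      (c k - hφ.mon (a - β k) (γ k)) + ∑ j, x j * e j o k := by
    rw [← h2]
    simp only [Pi.sub_apply, Finset.sum_apply, Pi.smul_apply, smul_eq_mul, mul_sub,
      Finset.sum_sub_distrib]
    ring
  rw [h3]
  refine Ideal.add_mem _ (hcγ k) (Ideal.sum_mem _ fun j _ => ?_)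
  by_cases hj : γ j = 0
  · simp [x, hj, mon_zero]
  · have := hφ.mon_mul_mem_ltIdeal (b := a - β j ⊔ β o) (he j o k) (γ j * lc j)
    rwa [tsub_add_cancel_of_le (hle j hj)] at this

/-- Reduction of a representation `∑ cⱼ gⱼ` by syzygies that lift those of the initial terms. -/
theorem forall_exists_sub_mem_ltIdeal [DecidableEq J] (hm : m.IsNoetherianOrder)
    (hg : ∀ j, IsInitialExponent m (φ (g j)) (β j))
    {T : Submodule A (J → A)} (hTg : ∀ t ∈ T, ∑ j, t j * g j = 0) {e : J → J → J → A}
    (he : ∀ i j k, e i j k ∈ ltIdeal φ m (β i ⊔ β j) (β k))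
    (hT : ∀ i j, hφ.sPair β (fun j => coeff (β j) (φ (g j))) i j - e i j ∈ T) {c : J → A}
    (hc : ∀ a, IsInitialExponent m (φ (∑ j, c j * g j)) a → ∀ j, ¬ β j ≤ a) (a : Fin d →₀ ℕ) :
    ∃ t ∈ T, ∀ j, (c - t) j ∈ ltIdeal φ m a (β j) := by
  refine hm.induction_lt (P := fun a => ∃ t ∈ T, ∀ j, (c - t) j ∈ leIdeal φ m a (β j))
    (Q := fun a => ∃ t ∈ T, ∀ j, (c - t) j ∈ ltIdeal φ m a (β j))
    ⟨0, zero_mem _, fun j => mem_leIdeal_zero _ _⟩ ?_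
    (fun a b h ⟨t, ht, hct⟩ => ⟨t, ht, fun j => ltIdeal_le_leIdeal h _ (hct j)⟩) a
  rintro a ⟨t, ht, hct⟩
  have hsum : ∑ j, (c - t) j * g j = ∑ j, c j * g j := by
    simp [sub_mul, Finset.sum_sub_distrib, hTg t ht]
  have hcoeff : coeff a (φ (∑ j, c j * g j)) =
      ∑ j, shiftedCoeff φ a (β j) ((c - t) j) * coeff (β j) (φ (g j)) := by
    rw [← hsum, map_sum, map_sum]
    exact Finset.sum_congr rfl fun j _ => hφ.coeff_mul_eq_shiftedCoeff (hct j) (hg j)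
  -- Either the level-`a` terms cancel and can be lifted away, or `a` is the initial exponent of the
  -- sum and some `β j` divides it, contrary to `hc`.
  by_cases h0 : coeff a (φ (∑ j, c j * g j)) = 0
  · obtain ⟨t', ht', h⟩ := hφ.exists_sub_mem_ltIdeal (fun j => (hg j).1) he hT hct
      (hcoeff.symm.trans h0)
    exact ⟨t + t', add_mem ht ht', fun j => by rw [← sub_sub]; exact h j⟩
  · exfalso
    have hinit : IsInitialExponent m (φ (∑ j, c j * g j)) a :=
      isInitialExponent_of_mem_leIdeal (hsum ▸ sum_mul_mem_leIdeal hg hct) h0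
    rw [hcoeff] at h0
    obtain ⟨j, -, hj⟩ := Finset.exists_ne_zero_of_sum_ne_zero h0
    exact hc a hinit j (le_of_shiftedCoeff_ne_zero (left_ne_zero_of_mul hj))

end StandardBasis

end IsSeriesRing

/-! ### Perturbation of a regular sequence -/

section AlternatingRelations

variable {A : Type*} [CommRing A] {J : Type*} [Fintype J] {r : ℕ}

/-- The relations among `∑ₚ M j p * f p` that come from Koszul relations of `f`. -/
def koszulRelations (M : J → Fin r → A) (f : Fin r → A) : Submodule A (J → A) where
  carrier := {t | ∃ D : Matrix (Fin r) (Fin r) A, D.IsAlternating ∧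
    ∀ p, ∑ k, t k * M k p = ∑ q, D p q * f q}
  zero_mem' := ⟨0, ⟨fun _ _ => by simp, fun _ => rfl⟩, fun p => by simp⟩
  add_mem' := by
    rintro s t ⟨D, hD, hs⟩ ⟨E, hE, ht⟩
    refine ⟨D + E, ⟨fun i j => ?_, fun i => ?_⟩, fun p => ?_⟩
    · rw [Matrix.add_apply, Matrix.add_apply, hD.1, hE.1, neg_add]
    · rw [Matrix.add_apply, hD.2, hE.2, add_zero]
    · simp only [Pi.add_apply, Matrix.add_apply, add_mul, Finset.sum_add_distrib, hs, ht]
  smul_mem' := by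
    rintro x t ⟨D, hD, ht⟩
    refine ⟨x • D, ⟨fun i j => ?_, fun i => ?_⟩, fun p => ?_⟩
    · rw [Matrix.smul_apply, Matrix.smul_apply, hD.1, smul_neg]
    · rw [Matrix.smul_apply, hD.2, smul_zero]
    · simp only [Pi.smul_apply, Matrix.smul_apply, smul_eq_mul, mul_assoc, ← Finset.mul_sum, ht]

theorem sum_mul_sum_comm (M : J → Fin r → A) (f : Fin r → A) (t : J → A) :
    ∑ k, t k * ∑ p, M k p * f p = ∑ p, (∑ k, t k * M k p) * f p := by
  simp_rw [Finset.mul_sum, Finset.sum_mul]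
  rw [Finset.sum_comm]
  simp_rw [mul_assoc]

theorem sum_mul_eq_zero_of_mem_koszulRelations {M : J → Fin r → A} {f : Fin r → A} {t : J → A}
    (ht : t ∈ koszulRelations M f) : ∑ k, t k * ∑ p, M k p * f p = 0 := by
  obtain ⟨D, hD, h⟩ := ht
  rw [sum_mul_sum_comm]
  simp_rw [h]
  exact hD.sum_mul_sum_eq_zero f

end AlternatingRelations

namespace IsSeriesRing

variable {d : ℕ} {K A : Type*} [Field K] [CommRing A] {φ : A →+* MvPowerSeries (Fin d) K}
  {m : MonomialOrder (Fin d)}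

theorem isInitialExponent_of_sub_mem {u v : A} {a : Fin d →₀ ℕ}
    (hu : IsInitialExponent m (φ u) a) (h : u - v ∈ ltIdeal φ m a 0) :
    IsInitialExponent m (φ v) a ∧ coeff a (φ v) = coeff a (φ u) := by
  have ha := coeff_eq_zero_of_mem_ltIdeal h
  rw [map_sub, map_sub, sub_eq_zero] at ha
  refine ⟨⟨ha ▸ hu.1, fun b hb => ?_⟩, ha.symm⟩
  by_contra hlt
  have h1 : coeff b (φ u) = 0 := by
    by_contra h1
    exact hlt (hu.2 b h1)
  have h2 := h b (by rw [map_sub, map_sub, h1, zero_sub]; simpa using hb)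
  rw [add_zero] at h2
  exact hlt h2.le

variable (hφ : IsSeriesRing φ)

include hφ in
theorem exists_isInitialExponent (m : MonomialOrder (Fin d)) {u : A} (hu : u ≠ 0) :
    ∃ a, IsInitialExponent m (φ u) a :=
  (existsUnique_isInitialExponent m fun h => hu (hφ.injective (h.trans (map_zero φ).symm))).exists

omit m in
theorem ne_zero_of_isRegularFamily {r : ℕ} {f : Fin r → A} (hf : IsRegularFamily f)
    (hf1 : ∀ p, f p ∈ orderIdeal φ 1) (p : Fin r) : f p ≠ 0 := fun h0 => by
  have h1 := hf p 1 (by simp [h0])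
  have h2 : Ideal.span (f '' Set.Iio p) ≤ orderIdeal φ 1 :=
    Ideal.span_le.2 (by rintro _ ⟨q, -, rfl⟩; exact hf1 q)
  have := h2 h1 0 (by simp)
  simp at this

include hφ in
/-- A sufficiently small perturbation of a regular sequence has the same initial exponents up to
divisibility, and only has relations that are Koszul up to terms of high order. -/
theorem exists_forall_perturbation (hm : m.IsNoetherianOrder) {r : ℕ} {f : Fin r → A}
    (hf : IsRegularFamily f) (hf1 : ∀ p, f p ∈ orderIdeal φ 1) :
    ∃ N, ∀ f' : Fin r → A, (∀ p, f p - f' p ∈ orderIdeal φ N) →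
      (∀ u ∈ Ideal.span (Set.range f), ∀ a, IsInitialExponent m (φ u) a →
        ∃ b ≤ a, ∃ v ∈ Ideal.span (Set.range f'), IsInitialExponent m (φ v) b) ∧
      (∀ u ∈ Ideal.span (Set.range f'), ∀ a, IsInitialExponent m (φ u) a →
        ∃ b ≤ a, ∃ v ∈ Ideal.span (Set.range f), IsInitialExponent m (φ v) b) ∧
      ∀ c : Fin r → A, ∑ p, c p * f' p = 0 → ∀ n, ∃ D : Matrix (Fin r) (Fin r) A,
        D.IsAlternating ∧ ∀ p, c p - ∑ q, D p q * f' q ∈ orderIdeal φ n := by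
  classical
  set I := Ideal.span (Set.range f) with hI
  obtain ⟨B, hB, hle⟩ := exists_finset_forall_exists_le
    {a : Fin d →₀ ℕ | ∃ u ∈ I, IsInitialExponent m (φ u) a}
  choose x hxI hx using fun b : B => hB b b.2
  choose α hα using fun p => hφ.exists_isInitialExponent m (ne_zero_of_isRegularFamily hf hf1 p)
  choose w hw using fun b => Ideal.mem_span_range_iff_exists_fun.1 (hxI b)
  -- The `f_p` are kept in the family beside the standard basis, so that coefficient vectors with
  -- respect to `f'` embed as vectors supported on the left summand.
  let β : Fin r ⊕ B → Fin d →₀ ℕ := Sum.elim α Subtype.val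
  let M : Fin r ⊕ B → Fin r → A := Sum.elim (fun p => Pi.single p 1) w
  have hM : ∀ (h : Fin r → A) p, ∑ q, M (Sum.inl p) q * h q = h p := by
    intro h p
    simp only [M, Sum.elim_inl, sum_single_mul, one_mul]
  let G : (Fin r → A) → Fin r ⊕ B → A := fun h j => ∑ p, M j p * h p
  have hg : ∀ j, IsInitialExponent m (φ (G f j)) (β j) := by
    rintro (p | b)
    · simp only [G, hM]
      exact hα p
    · simp only [G, M, Sum.elim_inr, hw]
      exact hx b
  have hGmem : ∀ h j, G h j ∈ Ideal.span (Set.range h) := fun h j =>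
    Ideal.sum_mem _ fun p _ => Ideal.mul_mem_left _ _ (Ideal.subset_span ⟨p, rfl⟩)
  have hspan : Ideal.span (Set.range (G f)) = I := by
    refine le_antisymm (Ideal.span_le.2 (Set.range_subset_iff.2 (hGmem f)))
      (Ideal.span_mono (Set.range_subset_iff.2 fun p => ⟨Sum.inl p, hM f p⟩))
  have hstd : ∀ u ∈ Ideal.span (Set.range (G f)), ∀ a, IsInitialExponent m (φ u) a →
      ∃ j, β j ≤ a := by
    intro u hu a ha
    obtain ⟨b, hb, hba⟩ := hle a ⟨u, hspan ▸ hu, ha⟩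
    exact ⟨Sum.inr ⟨b, hb⟩, hba⟩
  set lc : Fin r ⊕ B → K := fun j => coeff (β j) (φ (G f j)) with hlc
  have hrep := fun i j => hφ.exists_standard_representation hm hg hstd
    (Ideal.sum_mem _ fun k _ => Ideal.mul_mem_left _ _ (Ideal.subset_span ⟨k, rfl⟩))
    (hφ.sum_sPair_mul_mem_ltIdeal hg i j)
  choose e he hesum using hrep
  have hsyz : ∀ i j, ∑ p, (∑ k, (hφ.sPair β lc i j - e i j) k * M k p) * f p = 0 := by
    intro i j
    rw [← sum_mul_sum_comm]
    have := hesum i j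
    simp only [Pi.sub_apply, sub_mul, Finset.sum_sub_distrib]
    exact sub_eq_zero.2 this.symm
  choose D hD hDs using fun i j => hf.exists_isAlternating (hsyz i j)
  choose N₁ hN₁ using fun j => hm.exists_degree (β j)
  choose N₂ hN₂ using fun i j => hm.exists_degree (β i ⊔ β j)
  -- The first part protects the initial terms of the family; the second puts the errors in the
  -- lifted S-pairs above `β i ⊔ β j`.
  let N := (Finset.univ.sup N₁) ⊔ Finset.univ.sup fun i => Finset.univ.sup (N₂ i)
  have hNlt : ∀ j k, orderIdeal φ N ≤ ltIdeal φ m (β j) k := fun j k =>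
    (orderIdeal_anti ((Finset.le_sup (Finset.mem_univ j)).trans le_sup_left)).trans
      (orderIdeal_le_ltIdeal (hN₁ j) k)
  have hNlt2 : ∀ i j k, orderIdeal φ N ≤ ltIdeal φ m (β i ⊔ β j) k := fun i j k =>
    (orderIdeal_anti (((Finset.le_sup (f := N₂ i) (Finset.mem_univ j)).trans
      (Finset.le_sup (f := fun i => Finset.univ.sup (N₂ i)) (Finset.mem_univ i))).trans
        le_sup_right)).trans (orderIdeal_le_ltIdeal (hN₂ i j) k)
  refine ⟨N, fun f' hf' => ?_⟩
  have hGsub : ∀ j, G f j - G f' j ∈ orderIdeal φ N := fun j => by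
    simp only [G, ← Finset.sum_sub_distrib, ← mul_sub]
    exact Ideal.sum_mem _ fun p _ => Ideal.mul_mem_left _ _ (hf' p)
  have hg' : ∀ j, IsInitialExponent m (φ (G f' j)) (β j) ∧ coeff (β j) (φ (G f' j)) = lc j :=
    fun j => isInitialExponent_of_sub_mem (hg j) (hNlt j 0 (hGsub j))
  have hlc' : (fun j => coeff (β j) (φ (G f' j))) = lc := funext fun j => (hg' j).2
  -- The correction `D (f - f')` turns the lift for `f` into one for `f'`, since `D f - D (f - f') =
  -- D f'` with the same alternating `D`.
  let y : (i j : Fin r ⊕ B) → Fin r ⊕ B → A := fun i j =>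
    Sum.elim (fun p => ∑ q, D i j p q * (f q - f' q)) 0
  have hy : ∀ i j k, y i j k ∈ orderIdeal φ N := by
    rintro i j (p | b)
    · exact Ideal.sum_mem _ fun q _ => Ideal.mul_mem_left _ _ (hf' q)
    · exact zero_mem _
  have hinl : ∀ (c : Fin r → A) p,
      ∑ k, (Sum.elim c 0 : Fin r ⊕ B → A) k * M k p = c p := by
    intro c p
    rw [Fintype.sum_sum_type, Finset.sum_eq_single p]
    · simp [M]
    · intro q _ hq
      simp [M, hq.symm]
    · simp
  have hT : ∀ i j, hφ.sPair β (fun j => coeff (β j) (φ (G f' j))) i j - (e i j + y i j) ∈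
      koszulRelations M f' := by
    intro i j
    refine ⟨D i j, hD i j, fun p => ?_⟩
    rw [hlc', ← sub_sub]
    simp only [Pi.sub_apply _ (y i j), sub_mul _ (y i j _), Finset.sum_sub_distrib]
    rw [hDs, hinl, ← Finset.sum_sub_distrib]
    refine Finset.sum_congr rfl fun q _ => ?_
    ring
  have hred := fun c hc => hφ.forall_exists_sub_mem_ltIdeal hm (fun j => (hg' j).1)
    (T := koszulRelations M f') (fun t ht => sum_mul_eq_zero_of_mem_koszulRelations ht)
    (fun i j k => Ideal.add_mem _ (he i j k) (hNlt2 i j (β k) (hy i j k))) hT (c := c) hc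
  have hsumG : ∀ c : Fin r → A,
      ∑ k, (Sum.elim c 0 : Fin r ⊕ B → A) k * G f' k = ∑ p, c p * f' p := fun c => by
    simp only [G, sum_mul_sum_comm, hinl]
  refine ⟨fun u hu a ha => ?_, fun u hu a ha => ?_, fun c hc n => ?_⟩
  · obtain ⟨b, hb, hba⟩ := hle a ⟨u, hu, ha⟩
    exact ⟨b, hba, _, hGmem f' (Sum.inr ⟨b, hb⟩), (hg' (Sum.inr ⟨b, hb⟩)).1⟩
  · obtain ⟨c, rfl⟩ := Ideal.mem_span_range_iff_exists_fun.1 hu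
    suffices ∃ j, β j ≤ a by
      obtain ⟨j, hj⟩ := this
      exact ⟨β j, hj, _, hGmem f j, hg j⟩
    -- If no `β j` divided `a`, the reduction would represent the same element with all products
    -- above `a`, so its coefficient at `a` would vanish.
    by_contra! hcon
    rw [← hsumG] at ha
    obtain ⟨t, ht, hct⟩ := hred (Sum.elim c 0) (fun a' ha' => by
      have : a' = a := m.toSyn.injective (le_antisymm (ha'.2 _ ha.1) (ha.2 _ ha'.1))
      rwa [this]) a
    have h := coeff_eq_zero_of_mem_ltIdeal (sum_mul_mem_ltIdeal (fun j => (hg' j).1) hct)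
    simp only [Pi.sub_apply, sub_mul, Finset.sum_sub_distrib,
      sum_mul_eq_zero_of_mem_koszulRelations ht, G, sub_zero] at h
    exact ha.1 h
  · obtain ⟨a, ha⟩ := exists_ltIdeal_le_orderIdeal φ m β n
    -- The sum is zero and has no initial exponent, so the reduction is never obstructed and reaches
    -- every level.
    obtain ⟨t, ⟨E, hE, htE⟩, hct⟩ := hred (Sum.elim c 0) (fun a' ha' => by
      rw [hsumG, hc] at ha'
      exact absurd (by simp) ha'.1) a
    refine ⟨E, hE, fun p => ?_⟩
    rw [← htE, ← hinl c, ← Finset.sum_sub_distrib]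
    refine Ideal.sum_mem _ fun k _ => ?_
    rw [← sub_mul]
    exact Ideal.mul_mem_right _ _ (ha k (hct k))

include hφ in
theorem exists_forall_isRegularFamily (hm : m.IsNoetherianOrder) {r : ℕ} {f : Fin r → A}
    (hf : IsRegularFamily f) (hf1 : ∀ p, f p ∈ orderIdeal φ 1) :
    ∃ N, ∀ f' : Fin r → A, (∀ p, f p - f' p ∈ orderIdeal φ N) → IsRegularFamily f' := by
  induction r with
  | zero => exact ⟨0, fun f' _ i => i.elim0⟩
  | succ r ih =>
    obtain ⟨N₁, hN₁⟩ := ih hf.castSucc fun p => hf1 _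
    obtain ⟨N₂, hN₂⟩ := hφ.exists_forall_perturbation hm hf hf1
    refine ⟨max N₁ N₂, fun f' hf' => isRegularFamily_succ
      (hN₁ _ fun p => orderIdeal_anti (le_max_left _ _) (hf' _)) fun x hx => ?_⟩
    have hrel := (hN₂ f' fun p => orderIdeal_anti (le_max_right _ _) (hf' p)).2.2
    obtain ⟨c, hc⟩ := Ideal.mem_span_range_iff_exists_fun.1 hx
    refine hφ.mem_of_forall_exists_sub_mem _ fun n => ?_
    obtain ⟨D, hD, hsub⟩ := hrel (Fin.snoc (α := fun _ => A) (-c) x) (by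
      rw [Fin.sum_univ_castSucc]
      simp only [Fin.snoc_castSucc, Fin.snoc_last, Pi.neg_apply, neg_mul, Finset.sum_neg_distrib,
        hc]
      ring) n
    refine ⟨∑ q, D (Fin.last r) q * f' q, ?_, by simpa using hsub (Fin.last r)⟩
    -- The zero diagonal removes `f'` at the last index, so the approximation of `x` lies in the
    -- ideal of the preceding ones. `D` depends on `n`, which is why closedness of ideals is needed.
    rw [Fin.sum_univ_castSucc, hD.2, zero_mul, add_zero]
    exact Ideal.sum_mem _ fun q _ => Ideal.mul_mem_left _ _ (Ideal.subset_span ⟨q, rfl⟩)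

/-- The ideal generated by the initial monomials of the nonzero elements of `I`. -/
noncomputable def initialIdeal (m : MonomialOrder (Fin d)) (I : Ideal A) : Ideal A :=
  Ideal.span {g | ∃ u ∈ I, ∃ a, IsInitialExponent m (φ u) a ∧ g = hφ.mon a 1}

theorem initialIdeal_le {I I' : Ideal A} (h : ∀ u ∈ I, ∀ a, IsInitialExponent m (φ u) a →
    ∃ b ≤ a, ∃ v ∈ I', IsInitialExponent m (φ v) b) :
    hφ.initialIdeal m I ≤ hφ.initialIdeal m I' := by
  refine Ideal.span_le.2 ?_
  rintro _ ⟨u, hu, a, ha, rfl⟩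
  obtain ⟨b, hba, v, hv, hb⟩ := h u hu a ha
  have : hφ.mon a 1 = hφ.mon (a - b) 1 * hφ.mon b 1 := by
    rw [mon_mul_mon, tsub_add_cancel_of_le hba, one_mul]
  rw [this]
  exact Ideal.mul_mem_left _ _ (Ideal.subset_span ⟨v, hv, b, hb, rfl⟩)

theorem exists_forall_isRegular (hm : m.IsNoetherianOrder) {r : ℕ} {f : Fin r → A}
    (hf : RingTheory.Sequence.IsRegular A (List.ofFn f)) :
    ∃ N, ∀ f' : Fin r → A, (∀ p, f p - f' p ∈ orderIdeal φ N) →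
      RingTheory.Sequence.IsRegular A (List.ofFn f') ∧
        hφ.initialIdeal m (Ideal.span (Set.range f)) =
          hφ.initialIdeal m (Ideal.span (Set.range f')) := by
  obtain ⟨hreg, htop⟩ := (isRegular_ofFn_iff f).1 hf
  have hf1 : ∀ p, f p ∈ orderIdeal φ 1 := by
    intro p b hb
    have hb0 : b = 0 := (Finsupp.degree_eq_zero_iff b).1 (Nat.lt_one_iff.1 hb)
    subst hb0
    by_contra hne
    exact htop (Ideal.eq_top_of_isUnit_mem _ (Ideal.subset_span ⟨p, rfl⟩)
      (hφ.isUnit_of_coeff_zero_ne_zero hne))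
  obtain ⟨N₁, hN₁⟩ := hφ.exists_forall_isRegularFamily hm hreg hf1
  obtain ⟨N₂, hN₂⟩ := hφ.exists_forall_perturbation hm hreg hf1
  -- The 1 keeps constant terms zero, so that `f'` generates a proper ideal.
  refine ⟨max (max N₁ N₂) 1, fun f' hf' => ?_⟩
  obtain ⟨h1, h2, -⟩ := hN₂ f' fun p =>
    orderIdeal_anti ((le_max_right _ _).trans (le_max_left _ _)) (hf' p)
  refine ⟨(isRegular_ofFn_iff f').2 ⟨hN₁ f' fun p =>
    orderIdeal_anti ((le_max_left _ _).trans (le_max_left _ _)) (hf' p), fun h => ?_⟩,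
    le_antisymm (hφ.initialIdeal_le h1) (hφ.initialIdeal_le h2)⟩
  have hle : Ideal.span (Set.range f') ≤ orderIdeal φ 1 := by
    refine Ideal.span_le.2 (Set.range_subset_iff.2 fun p => ?_)
    have := Ideal.sub_mem _ (hf1 p) (orderIdeal_anti (le_max_right _ _) (hf' p))
    rwa [sub_sub_cancel] at this
  have h0 := hle (h ▸ Submodule.mem_top : (1 : A) ∈ _) 0 (by simp)
  simp at h0

end IsSeriesRing

/-! ### The formal and the convergent case -/

theorem exists_division_powerSeries {d : ℕ} {K : Type*} [Field K] {J : Type*} [Fintype J]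
    (β : J → Fin d →₀ ℕ) (g : J → MvPowerSeries (Fin d) K) (hβ : ∀ j, coeff (β j) (g j) = 1)
    (hg : ∀ j b, coeff b (g j) ≠ 0 → b ≠ β j → primeWeight (β j) < primeWeight b) :
    (∀ j e, coeff e (monomial (β j) 1 - g j) ≠ 0 → primeWeight (β j) < primeWeight e) ∧
    ∀ u : MvPowerSeries (Fin d) K, ∃ (s : (Fin d →₀ ℕ) → Option J) (v : (Fin d →₀ ℕ) → K),
      (∀ a, v a = coeff a u +
        ∑ j, coeff a (divisionQuotient β s v j * (monomial (β j) 1 - g j))) ∧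
      ∀ b j, β j ≤ b → coeff b (u - ∑ j, divisionQuotient β s v j * g j) = 0 := by
  classical
  have hh : ∀ j e, coeff e (monomial (β j) 1 - g j) ≠ 0 → primeWeight (β j) < primeWeight e := by
    intro j e he
    have hne : e ≠ β j := by
      rintro rfl
      simp [hβ] at he
    refine hg j e (fun h0 => he ?_) hne
    rw [map_sub, coeff_monomial, if_neg hne, h0, sub_zero]
  refine ⟨hh, fun u => ?_⟩
  let s : (Fin d →₀ ℕ) → Option J := fun a =>
    if h : ∃ j, β j ≤ a then some h.choose else none
  have hs : ∀ a j, s a = some j → β j ≤ a := by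
    intro a j h
    by_cases hex : ∃ j, β j ≤ a
    · simp only [s, dif_pos hex, Option.some.injEq] at h
      exact h ▸ hex.choose_spec
    · simp [s, dif_neg hex] at h
  obtain ⟨v, hv⟩ := exists_division_fixedPoint β (fun j => monomial (β j) 1 - g j) hh s u
  exact ⟨s, v, hv, fun b j hb => coeff_sub_sum_divisionQuotient hs hv b
    (by simp only [s, dif_pos (⟨j, hb⟩ : ∃ j, β j ≤ b)]; simp)⟩

theorem isSeriesRing_id (d : ℕ) (K : Type*) [Field K] :
    IsSeriesRing (RingHom.id (MvPowerSeries (Fin d) K)) where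
  injective := Function.injective_id
  exists_monomial a k := ⟨monomial a k, rfl⟩
  exists_division β g hβ hg u := by
    obtain ⟨s, v, -, h⟩ := (exists_division_powerSeries β g hβ hg).2 u
    exact ⟨divisionQuotient β s v, h⟩

theorem ConvergentPowerSeries.isSeriesRing (d : ℕ) (𝕜 : Type*) [RCLike 𝕜] :
    IsSeriesRing (ConvergentPowerSeries d 𝕜).val.toRingHom where
  injective := Subtype.val_injective
  exists_monomial a k :=
    ⟨ConvergentPowerSeries.ofPolynomial (MvPolynomial.monomial a k), MvPolynomial.coe_monomial a k⟩
  exists_division {J} _ β g hβ hg u := by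
    obtain ⟨hh, hdiv⟩ := exists_division_powerSeries β (fun j => (g j).1) hβ hg
    obtain ⟨s, v, hv, h⟩ := hdiv u.1
    have hc : ∀ j, (monomial (β j) (1 : 𝕜) - (g j).1).IsConvergent := fun j =>
      (ConvergentPowerSeries d 𝕜).sub_mem
        (by
          rw [← MvPolynomial.coe_monomial]
          exact MvPowerSeries.isConvergent_coe _) (g j).2
    refine ⟨fun j => ⟨divisionQuotient β s v j,
      isConvergent_of_division_fixedPoint hc hh u.2 hv j⟩, fun b j hb => ?_⟩
    rw [map_sub, map_sum]
    simp only [map_mul]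
    exact h b j hb

theorem coeff_sub_formalJet {d n : ℕ} {K : Type*} [Field K] (f : MvPowerSeries (Fin d) K)
    {b : Fin d →₀ ℕ} (hb : b.degree ≤ n) : coeff b (f - formalJet n f) = 0 := by
  rw [map_sub, formalJet, MvPolynomial.coeff_coe, jetPolynomial,
    coeff_truncTotal _ (Nat.lt_succ_of_le hb), sub_self]

theorem formalInitialIdeal_eq {d : ℕ} {K : Type*} [Field K] (m : MonomialOrder (Fin d))
    (I : Ideal (MvPowerSeries (Fin d) K)) :
    formalInitialIdeal m I = (isSeriesRing_id d K).initialIdeal m I := by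
  have : ∀ a, (isSeriesRing_id d K).mon a 1 = monomial a 1 := fun a =>
    (isSeriesRing_id d K).map_mon a 1
  simp only [formalInitialIdeal, IsSeriesRing.initialIdeal, this]
  rfl

theorem convergentInitialIdeal_eq {d : ℕ} {𝕜 : Type*} [RCLike 𝕜] (m : MonomialOrder (Fin d))
    (I : Ideal (ConvergentPowerSeries d 𝕜)) :
    convergentInitialIdeal m I = (ConvergentPowerSeries.isSeriesRing d 𝕜).initialIdeal m I := by
  have : ∀ a, (ConvergentPowerSeries.isSeriesRing d 𝕜).mon a 1 =
      ConvergentPowerSeries.ofPolynomial (MvPolynomial.monomial a 1) := fun a =>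
    Subtype.ext (((ConvergentPowerSeries.isSeriesRing d 𝕜).map_mon a 1).trans
      (MvPolynomial.coe_monomial a 1).symm)
  simp only [convergentInitialIdeal, IsSeriesRing.initialIdeal, this]
  rfl

theorem mainTheorem6 (d : ℕ) (m : MonomialOrder (Fin d)) (hm : m.IsNoetherianOrder) :
    (∀ (K : Type*) [Field K] (r : ℕ) (f : Fin r → MvPowerSeries (Fin d) K),
      RingTheory.Sequence.IsRegular (MvPowerSeries (Fin d) K) (List.ofFn f) →
      ∃ N : ℕ, ∀ n ≥ N,
        RingTheory.Sequence.IsRegular (MvPowerSeries (Fin d) K)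
          (List.ofFn fun i => formalJet n (f i)) ∧
        formalInitialIdeal m (Ideal.span (Set.range f)) =
          formalInitialIdeal m (Ideal.span (Set.range fun i => formalJet n (f i)))) ∧
    (∀ (𝕜 : Type*) [RCLike 𝕜] (r : ℕ) (f : Fin r → ConvergentPowerSeries d 𝕜),
      RingTheory.Sequence.IsRegular (ConvergentPowerSeries d 𝕜) (List.ofFn f) →
      ∃ N : ℕ, ∀ n ≥ N,
        RingTheory.Sequence.IsRegular (ConvergentPowerSeries d 𝕜)
          (List.ofFn fun i => convergentJet n (f i)) ∧
        convergentInitialIdeal m (Ideal.span (Set.range f)) =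
          convergentInitialIdeal m
            (Ideal.span (Set.range fun i => convergentJet n (f i)))) := by
  constructor
  · intro K _ r f hf
    obtain ⟨N, hN⟩ := (isSeriesRing_id d K).exists_forall_isRegular hm hf
    refine ⟨N, fun n hn => ?_⟩
    rw [formalInitialIdeal_eq, formalInitialIdeal_eq]
    exact hN _ fun p b hb => coeff_sub_formalJet (f p) (hb.le.trans hn)
  · intro 𝕜 _ r f hf
    obtain ⟨N, hN⟩ := (ConvergentPowerSeries.isSeriesRing d 𝕜).exists_forall_isRegular hm hf
    refine ⟨N, fun n hn => ?_⟩
    rw [convergentInitialIdeal_eq, convergentInitialIdeal_eq]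
    exact hN _ fun p b hb => coeff_sub_formalJet (f p).1 (hb.le.trans hn)
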